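/- Let $\Sigma$ be a finite set of unary predicates. Words are finite, possibly empty, sequences $u=u_0\cdots u_{m-1}$ of letters $u_i\in\mathcal P(\Sigma)$; the positions of $u$ are $0,\dots,m-1$. $\mathrm{FO}^+$ is the set of first-order formulas without negation $$\varphi,\psi::=\bot\mid\top\mid \mathfrak b(x,y)\mid a(x)\mid\varphi\land\psi\mid\varphi\lor\psi\mid\exists x,\varphi\mid\forall x,\varphi ,\qquad a\in\Sigma,\ \mathfrak b\in\mathfrak B,$$ where the set $\mathfrak B$ of binary predicates is either $\{\le,<,\mathrm{succ},\mathrm{nsucc}\}$ or $\{\le,<\}$. Variables range over the positions of the word $u$, $a(x)$ means $a\in u_x$, $\mathrm{succ}(x,y)$ means $y=x+1$ and $\mathrm{nsucc}(x,y)$ means $y\ne x+1$. $\mathrm{FO}^{3+}$ is the set of formulas of $\mathrm{FO}^+$ in which at most three different variables occur (they may be reused). A closed formula describes the language of all words that satisfy it. $\mathrm{LTL}^+$ is the set of formulas $$\varphi,\psi::=\bot\mid\top\mid a\mid\varphi\land\psi\mid\varphi\lor\psi\mid \mathrm X\varphi\mid\varphi\,\mathrm U\,\psi\mid\varphi\,\mathrm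 R\,\psi,\qquad a\in\Sigma,$$ with the following semantics on a word $u=u_0\cdots u_{m-1}$ (possibly empty); $\bot,\top,\land,\lor$ have their usual meaning. * $u\models a$ iff $m>0$ and $a\in u_0$. * $u\models\mathrm X\varphi$ iff $u_1\cdots u_{m-1}\models\varphi$, where $u_1\cdots u_{m-1}$ is the empty word if $m\le 1$. * $u\models\varphi\,\mathrm U\,\psi$ iff there is $0\le i<m$ with $u_i\cdots u_{m-1}\models\psi$ and $u_j\cdots u_{m-1}\models\varphi$ for all $0\le j<i$. * $u\models\varphi\,\mathrm R\,\psi$ iff $u\models\psi\,\mathrm U\,(\psi\land\varphi)$, or $u_i\cdots u_{m-1}\models\psi$ for all $0\le i<m$. A formula describes the language of all words that satisfy it. Then, for either choice of $\mathfrak B$, the logics $\mathrm{FO}^+$, $\mathrm{LTL}^+$ and $\mathrm{FO}^{3+}$ describe the same languages over the alphabet $\mathcal P(\Sigma)$. -/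

import Mathlib

/-- The binary predicates `=`, `≠`, `≤`, `<`, `succ`, `nsucc` used to compare positions. -/
inductive BinPred : Type
  | eq | ne | le | lt | succ | nsucc

/-- The meaning of a binary predicate on two positions. -/
def BinPred.Holds : BinPred → ℕ → ℕ → Prop
  | .eq, i, j => i = j
  | .ne, i, j => i ≠ j
  | .le, i, j => i ≤ j
  | .lt, i, j => i < j
  | .succ, i, j => j = i + 1
  | .nsucc, i, j => j ≠ i + 1

/-- The signature `{≤, <, succ, nsucc}`. -/
def BinPred.all : Set BinPred := {.le, .lt, .succ, .nsucc}

/-- The signature `{≤, <}`. -/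
def BinPred.order : Set BinPred := {.le, .lt}

/-- Formulas of positive first-order logic over a set `B` of binary predicates and a set `α` of
unary predicates. Variables are natural numbers; there is no negation. -/
inductive FOPlus (B : Set BinPred) (α : Type*) : Type _
  | bot : FOPlus B α
  | top : FOPlus B α
  | rel (b : BinPred) (hb : b ∈ B) (x y : ℕ) : FOPlus B α
  | letter (a : α) (x : ℕ) : FOPlus B α
  | and (φ ψ : FOPlus B α) : FOPlus B α
  | or (φ ψ : FOPlus B α) : FOPlus B α
  | ex (x : ℕ) (φ : FOPlus B α) : FOPlus B α
  | all (x : ℕ) (φ : FOPlus B α) : FOPlus B α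

namespace FOPlus

variable {B : Set BinPred} {α : Type*}

/-- All the variables that occur in a formula, free or bound. -/
def vars : FOPlus B α → Finset ℕ
  | bot => ∅
  | top => ∅
  | rel _ _ x y => {x, y}
  | letter _ x => {x}
  | and φ ψ => φ.vars ∪ ψ.vars
  | or φ ψ => φ.vars ∪ ψ.vars
  | ex x φ => insert x φ.vars
  | all x φ => insert x φ.vars

/-- The free variables of a formula. -/
def freeVars : FOPlus B α → Finset ℕ
  | bot => ∅
  | top => ∅
  | rel _ _ x y => {x, y}
  | letter _ x => {x}
  | and φ ψ => φ.freeVars ∪ ψ.freeVars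
  | or φ ψ => φ.freeVars ∪ ψ.freeVars
  | ex x φ => φ.freeVars.erase x
  | all x φ => φ.freeVars.erase x

/-- A closed formula has no free variable. -/
def Closed (φ : FOPlus B α) : Prop := φ.freeVars = ∅

/-- Satisfaction of a formula in the word `u` under the assignment `ν`. A letter of `u` is a set
of unary predicates, and quantifiers range over the positions `0, …, u.length - 1` of `u`. -/
def Sat (u : List (Set α)) : FOPlus B α → (ℕ → ℕ) → Prop
  | bot, _ => False
  | top, _ => True
  | rel b _ x y, ν => b.Holds (ν x) (ν y)
  | letter a x, ν => ∃ h : ν x < u.length, a ∈ u[ν x]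
  | and φ ψ, ν => φ.Sat u ν ∧ ψ.Sat u ν
  | or φ ψ, ν => φ.Sat u ν ∨ ψ.Sat u ν
  | ex x φ, ν => ∃ i < u.length, φ.Sat u (Function.update ν x i)
  | all x φ, ν => ∀ i < u.length, φ.Sat u (Function.update ν x i)

/-- Satisfaction only depends on the values of the free variables. -/
theorem sat_congr (u : List (Set α)) (φ : FOPlus B α) :
    ∀ ν ν' : ℕ → ℕ, (∀ x ∈ φ.freeVars, ν x = ν' x) → (φ.Sat u ν ↔ φ.Sat u ν') := by
  have upd : ∀ (s : Finset ℕ) (ν ν' : ℕ → ℕ) (x i : ℕ), (∀ y ∈ s.erase x, ν y = ν' y) →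
      ∀ y ∈ s, Function.update ν x i y = Function.update ν' x i y := by
    intro s ν ν' x i h y hy
    by_cases hyx : y = x
    · subst hyx; simp
    · simp [hyx, h y (Finset.mem_erase.2 ⟨hyx, hy⟩)]
  induction φ with
  | bot => intros; rfl
  | top => intros; rfl
  | rel b hb x y => intro ν ν' h; simp [Sat, h x (by simp [freeVars]), h y (by simp [freeVars])]
  | letter a x => intro ν ν' h; simp [Sat, h x (by simp [freeVars])]
  | and φ ψ ih1 ih2 =>
    intro ν ν' h
    exact and_congr (ih1 ν ν' fun x hx => h x (by simp [freeVars, hx]))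
      (ih2 ν ν' fun x hx => h x (by simp [freeVars, hx]))
  | or φ ψ ih1 ih2 =>
    intro ν ν' h
    exact or_congr (ih1 ν ν' fun x hx => h x (by simp [freeVars, hx]))
      (ih2 ν ν' fun x hx => h x (by simp [freeVars, hx]))
  | ex x φ ih =>
    intro ν ν' h
    exact exists_congr fun i => and_congr Iff.rfl (ih _ _ (upd _ ν ν' x i h))
  | all x φ ih =>
    intro ν ν' h
    exact forall_congr' fun i => imp_congr Iff.rfl (ih _ _ (upd _ ν ν' x i h))

/-- The language described by a closed formula. The assignment plays no role for a closed
formula, see `sat_congr`. -/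
def language (φ : FOPlus B α) : Language (Set α) := {u | φ.Sat u fun _ => 0}

end FOPlus

/-- Formulas of positive linear temporal logic, without negation. -/
inductive LTLPlus (α : Type*) : Type _
  | bot : LTLPlus α
  | top : LTLPlus α
  | letter (a : α) : LTLPlus α
  | and (φ ψ : LTLPlus α) : LTLPlus α
  | or (φ ψ : LTLPlus α) : LTLPlus α
  | next (φ : LTLPlus α) : LTLPlus α
  | untl (φ ψ : LTLPlus α) : LTLPlus α
  | release (φ ψ : LTLPlus α) : LTLPlus α

namespace LTLPlus

variable {α : Type*}

/-- Satisfaction of a formula by a (possibly empty) word. The subformula below `next` is evaluated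
on the word without its first letter, which is the empty word if the word has only one letter. -/
def Sat : LTLPlus α → List (Set α) → Prop
  | bot, _ => False
  | top, _ => True
  | letter a, u => ∃ h : 0 < u.length, a ∈ u[0]
  | and φ ψ, u => φ.Sat u ∧ ψ.Sat u
  | or φ ψ, u => φ.Sat u ∨ ψ.Sat u
  | next φ, u => φ.Sat u.tail
  | untl φ ψ, u => ∃ i < u.length, ψ.Sat (u.drop i) ∧ ∀ j < i, φ.Sat (u.drop j)
  | release φ ψ, u =>
      (∃ i < u.length, (ψ.Sat (u.drop i) ∧ φ.Sat (u.drop i)) ∧ ∀ j < i, ψ.Sat (u.drop j)) ∨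
        ∀ i < u.length, ψ.Sat (u.drop i)

/-- The language described by a formula: the words that satisfy it at their first position. -/
def language (φ : LTLPlus α) : Language (Set α) := {u | φ.Sat u}

end LTLPlus

/-- The languages described by closed formulas of positive first-order logic over `B`. -/
def foPlusLanguages (B : Set BinPred) (α : Type*) : Set (Language (Set α)) :=
  {L | ∃ φ : FOPlus B α, φ.Closed ∧ φ.language = L}

/-- The languages described by closed formulas of positive first-order logic over `B` in which at
most three different variables occur (each may be quantified several times). -/
def fo3PlusLanguages (B : Set BinPred) (α : Type*) : Set (Language (Set α)) :=
  {L | ∃ φ : FOPlus B α, φ.vars.card ≤ 3 ∧ φ.Closed ∧ φ.language = L}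

/-- The languages described by formulas of positive linear temporal logic. -/
def ltlPlusLanguages (α : Type*) : Set (Language (Set α)) :=
  {L | ∃ φ : LTLPlus α, φ.language = L}

/-!
# Positive first-order logic and positive temporal logic on finite words

The translation of temporal formulas into first-order formulas with three variables is the standard
one (`LTLPlus.toFO`), and the inclusion of the languages of three-variable formulas in those of all
formulas is trivial. The content of the theorem is that every positive first-order formula is
equivalent to a temporal formula that is positive and only looks to the future.

A closed first-order formula of bounded quantifier depth is preserved by the game `BackForth` with
boundedly many rounds, where each round cuts both words at a position. This game is decided by
finitely many languages, which are obtained by iterating two operations, "there is a cut such that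
the left part is in `K`, the letter is above `a`, and the right part is in `L`" and its dual "each
cut has its left part in `K`, a letter not below `b` or its right part in `L`"
(`ChainDef.exists_finite_backForth`). It remains to see that these operations do not lead outside the
positive temporal languages. As a right part is a suffix, temporal formulas speak about it directly,
and the difficulty lies with the left part.

To deal with it, the properties of a *factor* of a word are described by chains: a chain factorizes
the factor into single letters and intervals on which some language `β` holds, and in addition tests
languages at the points of division, where all the languages are evaluated on the whole rest of the
word, beyond the end of the factor. Finite unions of chains over a class `𝓕` of languages (`ChainDef`)
are closed under intersection and composition; on the factor that is the whole word, a chain is a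
nested until (`ChainDef.setOf_nil_mem`). As in Rabinovich's proof of Kamp's theorem, the main point
is complementation (`ChainDef.not`). To keep track of positivity, it is stated as follows: if a
property is described by chains over `𝓕`, then its negation is described by chains over the
complements of the languages of `𝓕`. Applying it twice, around an existential cut, gives the
universal cut over `𝓕` itself. The two ingredients are:

* `Step.run_true_iff`: a chain describes some prefix of the factor iff it describes some prefix of
  the whole rest of the word, which is a condition in `𝓕` at the first position, and certain
  suffix conditions in `𝓕` occur in order in the factor. The negation of the latter is easy.
* `ChainDef.not_run`: if a chain ends with an interval on which `β` holds, then its failure is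
  witnessed either by the failure on all prefixes, or by a position where `β` fails and beyond which
  no prefix is described by the rest of the chain. Cutting at that position leads to shorter chains
  on the left, and to the previous situation on the right.

The argument only uses that `𝓕` is closed under some operations that form a self-dual set
(`IsTemporalClass`).
-/

/-! ### Factors of words and chains of steps -/

/-- A property of a factor `p` of a word, given the part `s` of the word that follows the factor. -/
abbrev FactorRel (A : Type*) := List A → List A → Prop

namespace FactorRel

variable {A : Type*}

/-- The factor is empty. -/
def eps : FactorRel A := fun p _ => p = []

/-- The factor splits into a factor with property `R` followed by one with property `S`. -/
def comp (R S : FactorRel A) : FactorRel A :=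
  fun p s => ∃ p₁ p₂, p = p₁ ++ p₂ ∧ R p₁ (p₂ ++ s) ∧ S p₂ s

/-- The factor splits into a part at all positions of which `β` holds and a part with
property `R`. -/
def star (β : Set (List A)) (R : FactorRel A) : FactorRel A
  | [], s => R [] s
  | a :: p, s => R (a :: p) s ∨ (a :: (p ++ s) ∈ β ∧ star β R p s)

theorem eps_comp (R : FactorRel A) : comp eps R = R := by
  funext p s
  refine propext ⟨?_, fun h => ⟨[], p, rfl, rfl, h⟩⟩
  rintro ⟨p₁, p₂, rfl, rfl, h⟩
  exact h

theorem star_comp (β : Set (List A)) (R T : FactorRel A) :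
    star β (comp R T) = comp (star β R) T := by
  funext p s
  induction p with
  | nil => simp [star, comp]
  | cons a p ih =>
    simp only [star, ih, eq_iff_iff]
    constructor
    · rintro (⟨p₁, p₂, h, h1, h2⟩ | ⟨hβ, p₁, p₂, rfl, h1, h2⟩)
      · refine ⟨p₁, p₂, h, ?_, h2⟩
        cases p₁ with
        | nil => exact h1
        | cons b p₁ => exact Or.inl h1
      · exact ⟨a :: p₁, p₂, rfl, Or.inr ⟨by simpa using hβ, h1⟩, h2⟩
    · rintro ⟨p₁, p₂, h, h1, h2⟩
      cases p₁ with
      | nil => exact Or.inl ⟨[], p₂, h, h1, h2⟩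
      | cons b p₁ =>
        obtain ⟨rfl, rfl⟩ := List.cons.inj h
        rcases h1 with h1 | ⟨hβ, h1⟩
        · exact Or.inl ⟨_, p₂, rfl, h1, h2⟩
        · exact Or.inr ⟨by simpa using hβ, p₁, p₂, rfl, h1, h2⟩

theorem star_of {β : Set (List A)} {R : FactorRel A} {p s : List A} (h : R p s) :
    star β R p s := by
  cases p with
  | nil => exact h
  | cons a p => exact Or.inl h

/-- `star β eps` says that `β` holds at all positions of the factor. -/
theorem star_eps_cons {β : Set (List A)} {a : A} {p s : List A} :
    star β eps (a :: p) s ↔ a :: (p ++ s) ∈ β ∧ star β eps p s := by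
  simp [star, eps]

theorem star_eps_of_append {β : Set (List A)} {p q s : List A}
    (h : star β eps (p ++ q) s) : star β eps q s := by
  induction p with
  | nil => exact h
  | cons a p ih => exact ih (star_eps_cons.1 h).2

theorem star_univ_eps (p s : List A) : star Set.univ eps p s := by
  induction p with
  | nil => rfl
  | cons a p ih => exact star_eps_cons.2 ⟨trivial, ih⟩

/-- Either `β` holds at all positions of the factor, or there is a last position where it fails. -/
theorem star_eps_or_exists_last (β : Set (List A)) (p s : List A) :
    star β eps p s ∨
      ∃ q b r, p = q ++ b :: r ∧ b :: (r ++ s) ∉ β ∧ star β eps r s := by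
  induction p with
  | nil => exact Or.inl rfl
  | cons a p ih =>
    rcases ih with ih | ⟨q, b, r, rfl, h1, h2⟩
    · by_cases h : a :: (p ++ s) ∈ β
      · exact Or.inl (star_eps_cons.2 ⟨h, ih⟩)
      · exact Or.inr ⟨[], a, p, rfl, h, ih⟩
    · exact Or.inr ⟨a :: q, b, r, rfl, h1, h2⟩

/-- Interleaving of two starred properties. -/
theorem star_and_star (β γ : Set (List A)) (R S : FactorRel A) (p s : List A) :
    (star β R p s ∧ star γ S p s) ↔
      star (β ∩ γ) (fun p s => (R p s ∧ star γ S p s) ∨ (star β R p s ∧ S p s)) p s := by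
  induction p with
  | nil => simp [star]
  | cons a p ih =>
    simp only [star, ← ih, Set.mem_inter_iff]
    tauto

end FactorRel


/-- The steps from which factors are described. The languages in a step are evaluated on the whole
rest of the word, from the current position of the factor on, and not only on the rest of the
factor. -/
inductive Step (A : Type*)
  /-- Do not move, and check that the rest of the word belongs to `γ`. -/
  | test (γ : Set (List A))
  /-- Move over one letter. -/
  | any
  /-- Move over any number of positions, at all of which `β` holds. -/
  | star (β : Set (List A))

namespace Step

open FactorRel

variable {A : Type*}

/-- Prefixing a property of factors by a step. -/
def act : Step A → FactorRel A → FactorRel A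
  | test γ, R => fun p s => p ++ s ∈ γ ∧ R p s
  | any, R => fun p s => ∃ a p', p = a :: p' ∧ R p' s
  | star β, R => FactorRel.star β R

/-- Prefixing a property of factors by a sequence of steps. -/
def run (P : List (Step A)) (T : FactorRel A) : FactorRel A := P.foldr act T

/-- The languages in the step belong to `𝓕`. -/
def Over (𝓕 : Set (Set (List A))) : Step A → Prop
  | test γ => γ ∈ 𝓕
  | any => True
  | star β => β ∈ 𝓕

theorem act_comp (i : Step A) (R T : FactorRel A) : act i (comp R T) = comp (act i R) T := by
  cases i with
  | test γ =>
    funext p s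
    simp only [act, comp, eq_iff_iff]
    constructor
    · rintro ⟨h, p₁, p₂, rfl, h1, h2⟩
      exact ⟨p₁, p₂, rfl, ⟨by simpa using h, h1⟩, h2⟩
    · rintro ⟨p₁, p₂, rfl, ⟨h, h1⟩, h2⟩
      exact ⟨by simpa using h, p₁, p₂, rfl, h1, h2⟩
  | any =>
    funext p s
    simp only [act, comp, eq_iff_iff]
    constructor
    · rintro ⟨a, _, rfl, p₁, p₂, rfl, h1, h2⟩
      exact ⟨a :: p₁, p₂, rfl, ⟨a, p₁, rfl, h1⟩, h2⟩
    · rintro ⟨_, p₂, rfl, ⟨a, p₁, rfl, h1⟩, h2⟩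
      exact ⟨a, _, rfl, p₁, p₂, rfl, h1, h2⟩
  | star β => exact star_comp β R T

theorem run_comp (P : List (Step A)) (R T : FactorRel A) :
    run P (comp R T) = comp (run P R) T := by
  induction P with
  | nil => rfl
  | cons i P ih =>
    change act i (run P _) = comp (act i (run P R)) T
    rw [ih, act_comp]

theorem run_eq_comp (P : List (Step A)) (T : FactorRel A) : run P T = comp (run P eps) T := by
  rw [← run_comp, eps_comp]

theorem run_append (P Q : List (Step A)) (T : FactorRel A) :
    run (P ++ Q) T = comp (run P eps) (run Q T) := by
  rw [← run_eq_comp]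
  exact List.foldr_append

theorem run_cons (i : Step A) (P : List (Step A)) (T : FactorRel A) :
    run (i :: P) T = act i (run P T) := rfl

end Step

/-! ### Properties described by finite unions of chains -/

section Chains

open FactorRel Step

variable {A : Type*}

/-- `R` is a finite union of properties described by sequences of steps whose languages belong to
`𝓕`. -/
def ChainDef (𝓕 : Set (Set (List A))) (R : FactorRel A) : Prop :=
  ∃ l : List (List (Step A)), (∀ P ∈ l, ∀ i ∈ P, i.Over 𝓕) ∧
    ∀ p s, R p s ↔ ∃ P ∈ l, run P eps p s

namespace ChainDef

variable {𝓕 : Set (Set (List A))} {R S : FactorRel A}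

theorem congr (h : ChainDef 𝓕 R) (e : ∀ p s, S p s ↔ R p s) : ChainDef 𝓕 S := by
  obtain ⟨l, hl, hR⟩ := h
  exact ⟨l, hl, fun p s => (e p s).trans (hR p s)⟩

theorem of_chain {P : List (Step A)} (h : ∀ i ∈ P, i.Over 𝓕) : ChainDef 𝓕 (run P eps) :=
  ⟨[P], by simpa using h, by simp⟩

theorem eps : ChainDef 𝓕 (FactorRel.eps : FactorRel A) := of_chain (P := []) (by simp)

theorem false : ChainDef 𝓕 (fun _ _ : List A => False) := ⟨[], by simp, by simp⟩

theorem union (hR : ChainDef 𝓕 R) (hS : ChainDef 𝓕 S) :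
    ChainDef 𝓕 (fun p s => R p s ∨ S p s) := by
  obtain ⟨l, hl, hR⟩ := hR
  obtain ⟨m, hm, hS⟩ := hS
  refine ⟨l ++ m, fun P hP => (List.mem_append.1 hP).elim (hl P) (hm P), fun p s => ?_⟩
  simp only [hR, hS, List.mem_append, or_and_right, exists_or]

theorem comp (hR : ChainDef 𝓕 R) (hS : ChainDef 𝓕 S) : ChainDef 𝓕 (comp R S) := by
  obtain ⟨l, hl, hR⟩ := hR
  obtain ⟨m, hm, hS⟩ := hS
  refine ⟨l.flatMap fun P => m.map fun Q => P ++ Q, ?_, fun p s => ?_⟩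
  · intro P hP i hi
    simp only [List.mem_flatMap, List.mem_map] at hP
    obtain ⟨P, hP, Q, hQ, rfl⟩ := hP
    exact (List.mem_append.1 hi).elim (hl P hP i) (hm Q hQ i)
  · simp only [List.mem_flatMap, List.mem_map, FactorRel.comp, hR, hS]
    constructor
    · rintro ⟨p₁, p₂, rfl, ⟨P, hP, h1⟩, Q, hQ, h2⟩
      exact ⟨_, ⟨P, hP, Q, hQ, rfl⟩, by rw [run_append]; exact ⟨p₁, p₂, rfl, h1, h2⟩⟩
    · rintro ⟨_, ⟨P, hP, Q, hQ, rfl⟩, h⟩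
      rw [run_append] at h
      obtain ⟨p₁, p₂, rfl, h1, h2⟩ := h
      exact ⟨p₁, p₂, rfl, ⟨P, hP, h1⟩, Q, hQ, h2⟩

theorem act {i : Step A} (hi : i.Over 𝓕) (hR : ChainDef 𝓕 R) : ChainDef 𝓕 (act i R) := by
  have h := (of_chain (P := [i]) (by simpa using hi)).comp hR
  rwa [← run_comp, eps_comp] at h

theorem any (hR : ChainDef 𝓕 R) : ChainDef 𝓕 (Step.act .any R) := hR.act (i := .any) trivial

theorem test {γ : Set (List A)} (hγ : γ ∈ 𝓕) (hR : ChainDef 𝓕 R) :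
    ChainDef 𝓕 (Step.act (.test γ) R) := hR.act (i := .test γ) hγ

theorem star {β : Set (List A)} (hβ : β ∈ 𝓕) (hR : ChainDef 𝓕 R) :
    ChainDef 𝓕 (FactorRel.star β R) := hR.act (i := .star β) hβ

theorem true (h : Set.univ ∈ 𝓕) : ChainDef 𝓕 (fun _ _ : List A => True) :=
  (eps.star h).congr fun p s => by simp [star_univ_eps]

/-- The intersection of two chains is the union of their interleavings. -/
theorem inter_chain (hint : ∀ L ∈ 𝓕, ∀ M ∈ 𝓕, L ∩ M ∈ 𝓕) :
    ∀ P Q : List (Step A), (∀ i ∈ P, i.Over 𝓕) → (∀ i ∈ Q, i.Over 𝓕) →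
      ChainDef 𝓕 (fun p s => run P FactorRel.eps p s ∧ run Q FactorRel.eps p s) := by
  intro P
  induction P with
  | nil =>
    intro Q _ hQ
    induction Q with
    | nil => exact eps.congr fun p s => and_self_iff
    | cons i Q ih =>
      have hi := hQ i (by simp)
      have ih := ih fun i h => hQ i (by simp [h])
      cases i with
      | test γ => exact (ih.test hi).congr fun p s => by simp [run_cons, Step.act]; tauto
      | any =>
        refine false.congr fun p s => iff_of_false ?_ id
        rintro ⟨h, a, p', h', -⟩
        exact List.cons_ne_nil a p' (h'.symm.trans h)
      | star β =>
        refine ih.congr fun p s => and_congr_right fun h => ?_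
        obtain rfl : p = [] := h
        rfl
  | cons i P ihP =>
    intro Q hP
    have hi := hP i (by simp)
    have hP' : ∀ i ∈ P, i.Over 𝓕 := fun i h => hP i (by simp [h])
    intro hQ
    induction Q with
    | nil =>
      have ih := ihP [] hP' (by simp)
      cases i with
      | test γ => exact (ih.test hi).congr fun p s => by simp [run_cons, Step.act]; tauto
      | any =>
        refine false.congr fun p s => iff_of_false ?_ id
        rintro ⟨⟨a, p', h', -⟩, h⟩
        exact List.cons_ne_nil a p' (h'.symm.trans h)
      | star β =>
        refine ih.congr fun p s => and_congr_left fun h => ?_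
        obtain rfl : p = [] := h
        rfl
    | cons j Q ihQ =>
      have hj := hQ j (by simp)
      have hQ' : ∀ i ∈ Q, i.Over 𝓕 := fun i h => hQ i (by simp [h])
      have ihQ := ihQ hQ'
      cases i with
      | test γ =>
        exact ((ihP (j :: Q) hP' hQ).test hi).congr fun p s => by
          simp [run_cons, Step.act]; tauto
      | any =>
        cases j with
        | test γ => exact (ihQ.test hj).congr fun p s => by simp [run_cons, Step.act]; tauto
        | any =>
          refine (ihP Q hP' hQ').any.congr fun p s => ?_
          simp only [run_cons, Step.act]
          constructor
          · rintro ⟨⟨a, p', rfl, h⟩, b, p'', e, h'⟩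
            obtain ⟨rfl, rfl⟩ := List.cons.inj e
            exact ⟨a, p', rfl, h, h'⟩
          · rintro ⟨a, p', rfl, h, h'⟩
            exact ⟨⟨a, p', rfl, h⟩, a, p', rfl, h'⟩
        | star β =>
          refine (ihQ.union ((ihP (.star β :: Q) hP' hQ).any.test hj)).congr fun p s => ?_
          simp only [run_cons, Step.act]
          cases p with
          | nil => simp
          | cons a p =>
            simp only [FactorRel.star, List.cons_append, List.cons.injEq]
            simp only [↓existsAndEq, true_and]
            tauto
      | star β =>
        cases j with
        | test γ => exact (ihQ.test hj).congr fun p s => by simp [run_cons, Step.act]; tauto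
        | any =>
          refine ((ihP (.any :: Q) hP' hQ).union (ihQ.any.test hi)).congr fun p s => ?_
          simp only [run_cons, Step.act]
          cases p with
          | nil => simp [FactorRel.star]
          | cons a p =>
            simp only [FactorRel.star, List.cons_append, List.cons.injEq]
            simp only [↓existsAndEq, true_and]
            tauto
        | star γ =>
          exact (((ihP (.star γ :: Q) hP' hQ).union ihQ).star (hint _ hi _ hj)).congr
            fun p s => star_and_star β γ _ _ p s

end ChainDef

/-! ### Classes of languages with temporal operators -/

/-- The words one of whose suffixes (possibly the empty one) belongs to `γ`, with all the longer
suffixes in `β`. -/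
def weakUntil (β γ : Set (List A)) : Set (List A) := {t | FactorRel.star β (fun p _ => p ∈ γ) t []}

theorem nil_mem_weakUntil {β γ : Set (List A)} : [] ∈ weakUntil β γ ↔ [] ∈ γ := Iff.rfl

theorem cons_mem_weakUntil {β γ : Set (List A)} {a : A} {t : List A} :
    a :: t ∈ weakUntil β γ ↔ a :: t ∈ γ ∨ (a :: t ∈ β ∧ t ∈ weakUntil β γ) := by
  simp [weakUntil, FactorRel.star]

theorem subset_weakUntil {β γ : Set (List A)} : γ ⊆ weakUntil β γ := fun _ h => star_of h

/-- The nonempty words that belong to `L` once their first letter is removed. -/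
def strongNext (L : Set (List A)) : Set (List A) := {t | ∃ a t', t = a :: t' ∧ t' ∈ L}

/-- A class of languages closed under the positive Boolean operations, `weakUntil`, `strongNext` and
the duals of these two. The definition is self-dual: the complements of such a class form such a
class. -/
structure IsTemporalClass (𝓕 : Set (Set (List A))) : Prop where
  empty : ∅ ∈ 𝓕
  univ : Set.univ ∈ 𝓕
  union : ∀ L ∈ 𝓕, ∀ M ∈ 𝓕, L ∪ M ∈ 𝓕
  inter : ∀ L ∈ 𝓕, ∀ M ∈ 𝓕, L ∩ M ∈ 𝓕
  strongNext : ∀ L ∈ 𝓕, strongNext L ∈ 𝓕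
  strongNext_dual : ∀ L ∈ 𝓕, (_root_.strongNext Lᶜ)ᶜ ∈ 𝓕
  weakUntil : ∀ L ∈ 𝓕, ∀ M ∈ 𝓕, weakUntil L M ∈ 𝓕
  weakUntil_dual : ∀ L ∈ 𝓕, ∀ M ∈ 𝓕, (_root_.weakUntil Lᶜ Mᶜ)ᶜ ∈ 𝓕

theorem IsTemporalClass.compl {𝓕 : Set (Set (List A))} (h : IsTemporalClass 𝓕) :
    IsTemporalClass (compl ⁻¹' 𝓕) where
  empty := by simpa using h.univ
  univ := by simpa using h.empty
  union L hL M hM := by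
    rw [Set.mem_preimage, Set.compl_union]; exact h.inter _ hL _ hM
  inter L hL M hM := by
    rw [Set.mem_preimage, Set.compl_inter]; exact h.union _ hL _ hM
  strongNext L hL := by simpa using h.strongNext_dual _ hL
  strongNext_dual L hL := by simpa using h.strongNext _ hL
  weakUntil L hL M hM := by simpa using h.weakUntil_dual _ hL _ hM
  weakUntil_dual L hL M hM := by simpa using h.weakUntil _ hL _ hM

theorem compl_preimage_compl (𝓕 : Set (Set (List A))) : compl ⁻¹' (compl ⁻¹' 𝓕) = 𝓕 := by
  ext; simp

theorem ChainDef.inter {𝓕 : Set (Set (List A))} (h𝓕 : IsTemporalClass 𝓕) {R S : FactorRel A}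
    (hR : ChainDef 𝓕 R) (hS : ChainDef 𝓕 S) : ChainDef 𝓕 (fun p s => R p s ∧ S p s) := by
  obtain ⟨l, hl, hR⟩ := hR
  obtain ⟨m, hm, hS⟩ := hS
  -- Intersections with a fixed chain, then with the union of chains.
  have key : ∀ P : List (Step A), (∀ i ∈ P, i.Over 𝓕) → ∀ m : List (List (Step A)),
      (∀ Q ∈ m, ∀ i ∈ Q, i.Over 𝓕) →
      ChainDef 𝓕 (fun p s => run P FactorRel.eps p s ∧ ∃ Q ∈ m, run Q FactorRel.eps p s) := by
    intro P hP m
    induction m with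
    | nil => exact fun _ => false.congr (by simp)
    | cons Q m ih =>
      intro hm
      refine ((inter_chain h𝓕.inter P Q hP (hm Q (by simp))).union
        (ih fun Q h => hm Q (by simp [h]))).congr fun p s => ?_
      simp only [List.mem_cons, exists_eq_or_imp, and_or_left]
  have : ChainDef 𝓕 (fun p s => (∃ P ∈ l, run P FactorRel.eps p s) ∧
      ∃ Q ∈ m, run Q FactorRel.eps p s) := by
    clear hR
    induction l with
    | nil => exact false.congr (by simp)
    | cons P l ih =>
      refine ((key P (hl P (by simp)) m hm).union (ih fun Q h => hl Q (by simp [h]))).congr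
        fun p s => ?_
      simp only [List.mem_cons, exists_eq_or_imp]
      exact or_and_right
  exact this.congr fun p s => and_congr (hR p s) (hS p s)

/-! ### Existence of a run on a prefix of the factor -/

namespace Step

/-- The words that have a prefix described by `P` (in the context of the whole word). -/
def prefixLang : List (Step A) → Set (List A)
  | [] => Set.univ
  | test γ :: P => γ ∩ prefixLang P
  | any :: P => strongNext (prefixLang P)
  | star β :: P => weakUntil β (prefixLang P)

/-- A relaxation of `run P` on a prefix of the factor. The steps `any` are kept, but in place of a
step `star β` any number of letters may be skipped, provided that the remaining steps can be run
from there on, possibly beyond the end of the factor. -/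
def Marks : List (Step A) → FactorRel A
  | [] => fun _ _ => True
  | test _ :: P => Marks P
  | any :: P => act any (Marks P)
  | star _ :: P => FactorRel.star Set.univ fun p s => p ++ s ∈ prefixLang P ∧ Marks P p s

theorem Marks.cons {P : List (Step A)} {a : A} {p s : List A} (h : Marks P p s) :
    Marks P (a :: p) s := by
  induction P generalizing a p with
  | nil => trivial
  | cons i P ih =>
    cases i with
    | test γ => exact ih h
    | any =>
      obtain ⟨b, p', rfl, h⟩ := h
      exact ⟨a, _, rfl, ih h⟩
    | star β => exact Or.inr ⟨trivial, h⟩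

theorem Marks.of_star {P : List (Step A)} {β : Set (List A)} {p s : List A}
    (h : Marks (star β :: P) p s) : Marks P p s := by
  induction p with
  | nil => exact h.2
  | cons a p ih =>
    rcases h with h | ⟨-, h⟩
    · exact h.2
    · exact (ih h).cons

/-- The steps can be run on some prefix of the factor as soon as they can be run on some prefix of
the rest of the word, and the relaxed condition `Marks` holds within the factor: at each step
`star β`, the run may go on from the first of the two positions that these conditions provide. -/
theorem run_true_iff (P : List (Step A)) (p s : List A) :
    run P (fun _ _ => True) p s ↔ p ++ s ∈ prefixLang P ∧ Marks P p s := by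
  induction P generalizing p with
  | nil => simp [run, prefixLang, Marks]
  | cons i P ih =>
    rw [run_cons]
    cases i with
    | test γ => simp [act, prefixLang, Marks, ih, and_assoc]
    | any =>
      simp only [act, prefixLang, Marks, ih, strongNext, Set.mem_ofPred_eq]
      constructor
      · rintro ⟨a, p', rfl, h1, h2⟩
        exact ⟨⟨a, _, rfl, h1⟩, a, p', rfl, h2⟩
      · rintro ⟨⟨b, t, h, h1⟩, a, p', rfl, h2⟩
        obtain ⟨rfl, rfl⟩ := List.cons.inj h
        exact ⟨_, p', rfl, h1, h2⟩
    | star β =>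
      simp only [act, prefixLang]
      induction p with
      | nil =>
        simp only [FactorRel.star, ih, Marks, List.nil_append]
        exact ⟨fun h => ⟨subset_weakUntil h.1, h⟩, fun h => h.2⟩
      | cons a p ihp =>
        have hm : ∀ {p}, Marks (.star β :: P) p s → Marks P p s := fun h => h.of_star
        specialize @hm p
        have hc := @Marks.cons A P a p s
        simp only [FactorRel.star, ih, ihp, Marks, List.cons_append, cons_mem_weakUntil,
          Set.mem_univ, true_and] at hm ⊢
        tauto

end Step

namespace ChainDef

variable {𝓕 : Set (Set (List A))}

theorem prefixLang_mem (h𝓕 : IsTemporalClass 𝓕) {P : List (Step A)} (hP : ∀ i ∈ P, i.Over 𝓕) :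
    prefixLang P ∈ 𝓕 := by
  induction P with
  | nil => exact h𝓕.univ
  | cons i P ih =>
    have hi := hP i (by simp)
    have ih := ih fun i h => hP i (by simp [h])
    cases i with
    | test γ => exact h𝓕.inter _ hi _ ih
    | any => exact h𝓕.strongNext _ ih
    | star β => exact h𝓕.weakUntil _ hi _ ih

theorem not_marks (h𝓕 : IsTemporalClass 𝓕) {P : List (Step A)} (hP : ∀ i ∈ P, i.Over 𝓕) :
    ChainDef (compl ⁻¹' 𝓕) (fun p s => ¬ Marks P p s) := by
  induction P with
  | nil => exact false.congr (by simp [Marks])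
  | cons i P ih =>
    have hi := hP i (by simp)
    have hP' : ∀ i ∈ P, i.Over 𝓕 := fun i h => hP i (by simp [h])
    have ih := ih hP'
    cases i with
    | test γ => exact ih
    | any =>
      refine (eps.union ih.any).congr fun p s => ?_
      cases p with
      | nil => simp [Marks, Step.act, FactorRel.eps]
      | cons a p =>
        simp only [Marks, Step.act, FactorRel.eps, List.cons.injEq]
        simp
    | star β =>
      have hG : (prefixLang P)ᶜ ∈ compl ⁻¹' 𝓕 := by
        simpa using prefixLang_mem h𝓕 hP'
      -- If `Marks P` fails at a position, it fails at all later ones. So it is enough to know that it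
      -- fails at the first position from which the remaining steps can be run, if there is one.
      refine (((eps.test hG).star hG).union (ih.star hG)).congr fun p s => ?_
      induction p with
      | nil =>
        simp only [Marks, FactorRel.star, Step.act, FactorRel.eps, Set.mem_compl_iff]
        tauto
      | cons a p ihp =>
        have hm : Marks (.star β :: P) p s → Marks P p s := fun h => h.of_star
        have hc := @Marks.cons A P a p s
        simp only [Marks] at ihp hm
        simp only [Marks, FactorRel.star, Step.act, FactorRel.eps, Set.mem_compl_iff,
          Set.mem_univ, true_and, List.cons_append, reduceCtorEq, and_false, false_or] at ihp ⊢
        tauto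

/-- The negation of the property that `P` describes some prefix of the factor. -/
theorem not_run_true (h𝓕 : IsTemporalClass 𝓕) {P : List (Step A)} (hP : ∀ i ∈ P, i.Over 𝓕) :
    ChainDef (compl ⁻¹' 𝓕) (fun p s => ¬ run P (fun _ _ => True) p s) := by
  have hG : (prefixLang P)ᶜ ∈ compl ⁻¹' 𝓕 := by simpa using prefixLang_mem h𝓕 hP
  refine (((true h𝓕.compl.univ).test hG).union (not_marks h𝓕 hP)).congr fun p s => ?_
  rw [run_true_iff]
  simp only [Step.act, Set.mem_compl_iff, and_true]
  tauto

end ChainDef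

/-! ### Complements of chains -/

namespace Step

/-- The ways of cutting a chain in two. A step `star β` may be cut in its middle and then occurs on
both sides. -/
def splits : List (Step A) → List (List (Step A) × List (Step A))
  | [] => [([], [])]
  | test γ :: P => (splits P).map fun c => (test γ :: c.1, c.2)
  | any :: P => ([], any :: P) :: (splits P).map fun c => (any :: c.1, c.2)
  | star β :: P => ([star β], star β :: P) :: (splits P).map fun c => (star β :: c.1, c.2)

theorem length_le_of_mem_splits {P : List (Step A)} {c : List (Step A) × List (Step A)}
    (h : c ∈ splits P) : c.1.length ≤ P.length := by
  induction P generalizing c with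
  | nil => simp_all [splits]
  | cons i P ih =>
    cases i <;> simp only [splits, List.mem_cons, List.mem_map] at h
    · obtain ⟨c, hc, rfl⟩ := h
      simpa using ih hc
    · obtain rfl | ⟨c, hc, rfl⟩ := h
      · simp
      · simpa using ih hc
    · obtain rfl | ⟨c, hc, rfl⟩ := h
      · simp
      · simpa using ih hc

theorem mem_of_mem_splits {P : List (Step A)} {c : List (Step A) × List (Step A)}
    (h : c ∈ splits P) : (∀ i ∈ c.1, i ∈ P) ∧ ∀ i ∈ c.2, i ∈ P := by
  induction P generalizing c with
  | nil => simp_all [splits]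
  | cons i P ih =>
    cases i <;> simp only [splits, List.mem_cons, List.mem_map] at h
    · obtain ⟨c, hc, rfl⟩ := h
      have := ih hc
      simp_all
    · obtain rfl | ⟨c, hc, rfl⟩ := h
      · simp
      · have := ih hc
        simp_all
    · obtain rfl | ⟨c, hc, rfl⟩ := h
      · simp
      · have := ih hc
        simp_all

theorem act_any_cons {R : FactorRel A} {a : A} {p s : List A} :
    act any R (a :: p) s ↔ R p s := by
  constructor
  · rintro ⟨b, p', h, h'⟩
    obtain ⟨rfl, rfl⟩ := List.cons.inj h
    exact h'
  · exact fun h => ⟨a, p, rfl, h⟩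

theorem run_eps_append_iff (P : List (Step A)) (p q s : List A) :
    run P eps (p ++ q) s ↔ ∃ c ∈ splits P, run c.1 eps p (q ++ s) ∧ run c.2 eps q s := by
  induction P generalizing p with
  | nil => simp [splits, run, eps]
  | cons i P ih =>
    cases i with
    | test γ =>
      simp only [splits, List.mem_map, run_cons, act, ih, List.append_assoc]
      constructor
      · rintro ⟨h, c, hc, h1, h2⟩
        exact ⟨_, ⟨c, hc, rfl⟩, ⟨h, h1⟩, h2⟩
      · rintro ⟨_, ⟨c, hc, rfl⟩, ⟨h, h1⟩, h2⟩
        exact ⟨h, c, hc, h1, h2⟩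
    | any =>
      simp only [splits, List.mem_cons, List.mem_map, exists_eq_or_imp]
      cases p with
      | nil =>
        refine ⟨fun h => Or.inl ⟨rfl, h⟩, ?_⟩
        rintro (⟨-, h⟩ | ⟨_, ⟨c, hc, rfl⟩, ⟨a, p', h, -⟩, -⟩)
        · exact h
        · exact absurd h.symm (List.cons_ne_nil a p')
      | cons a p =>
        simp only [run_cons, List.cons_append, act_any_cons, ih]
        constructor
        · rintro ⟨c, hc, h1, h2⟩
          exact Or.inr ⟨_, ⟨c, hc, rfl⟩, act_any_cons.2 h1, h2⟩
        · rintro (⟨h, -⟩ | ⟨_, ⟨c, hc, rfl⟩, h1, h2⟩)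
          · exact absurd h (List.cons_ne_nil a p)
          · exact ⟨c, hc, act_any_cons.1 h1, h2⟩
    | star β =>
      have key : FactorRel.star β (run P eps) (p ++ q) s ↔
          (FactorRel.star β eps p (q ++ s) ∧ FactorRel.star β (run P eps) q s) ∨
            ∃ c ∈ splits P, FactorRel.star β (run c.1 eps) p (q ++ s) ∧ run c.2 eps q s := by
        induction p with
        | nil =>
          refine ⟨fun h => Or.inl ⟨rfl, h⟩, ?_⟩
          rintro (⟨-, h⟩ | ⟨c, hc, h1, h2⟩)
          · exact h
          · exact star_of ((ih []).2 ⟨c, hc, h1, h2⟩)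
        | cons a p ihp =>
          have ih := ih (a :: p)
          rw [List.cons_append] at ih
          simp only [List.cons_append, FactorRel.star, ih, ihp, List.append_assoc]
          constructor
          · rintro (⟨c, hc, h1, h2⟩ | ⟨h, ⟨h1, h2⟩ | ⟨c, hc, h1, h2⟩⟩)
            · exact Or.inr ⟨c, hc, Or.inl h1, h2⟩
            · exact Or.inl ⟨Or.inr ⟨h, h1⟩, h2⟩
            · exact Or.inr ⟨c, hc, Or.inr ⟨h, h1⟩, h2⟩
          · rintro (⟨h | ⟨h, h1⟩, h2⟩ | ⟨c, hc, h1 | ⟨h, h1⟩, h2⟩)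
            · exact absurd h (List.cons_ne_nil a p)
            · exact Or.inr ⟨h, Or.inl ⟨h1, h2⟩⟩
            · exact Or.inl ⟨c, hc, h1, h2⟩
            · exact Or.inr ⟨h, Or.inr ⟨c, hc, h1, h2⟩⟩
      simp only [splits, List.mem_cons, List.mem_map, exists_eq_or_imp]
      refine key.trans (or_congr Iff.rfl ⟨?_, ?_⟩)
      · rintro ⟨c, hc, h⟩
        exact ⟨_, ⟨c, hc, rfl⟩, h⟩
      · rintro ⟨_, ⟨c, hc, rfl⟩, h⟩
        exact ⟨c, hc, h⟩

end Step

namespace ChainDef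

variable {𝓕 : Set (Set (List A))}

/-- Distributing conjunctions of disjunctions, each about the two parts of a factor. -/
theorem exists_append_forall (h𝓕 : IsTemporalClass 𝓕) {ι : Type*} (l : List ι)
    (X Y : ι → FactorRel A) (hX : ∀ c ∈ l, ChainDef 𝓕 (X c)) (hY : ∀ c ∈ l, ChainDef 𝓕 (Y c)) :
    ∀ Z W : FactorRel A, ChainDef 𝓕 Z → ChainDef 𝓕 W →
      ChainDef 𝓕 (fun p s => ∃ p₁ p₂, p = p₁ ++ p₂ ∧ Z p₁ (p₂ ++ s) ∧ W p₂ s ∧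
        ∀ c ∈ l, X c p₁ (p₂ ++ s) ∨ Y c p₂ s) := by
  induction l with
  | nil => exact fun Z W hZ hW => (hZ.comp hW).congr fun p s => by simp [FactorRel.comp]
  | cons c l ih =>
    intro Z W hZ hW
    have ih := ih (fun c h => hX c (by simp [h])) (fun c h => hY c (by simp [h]))
    refine ((ih _ _ (hZ.inter h𝓕 (hX c (by simp))) hW).union
      (ih _ _ hZ (hW.inter h𝓕 (hY c (by simp))))).congr fun p s => ?_
    simp only [List.mem_cons, forall_eq_or_imp, ← exists_or]
    refine exists_congr fun p₁ => exists_congr fun p₂ => ?_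
    tauto

/-- The complement of a chain is a finite union of chains. The case that matters is that of a chain
`P` followed by `star β`: the description fails iff no prefix of the factor is described by `P`, or
there is a position where `β` fails and no prefix that goes beyond this position is described by
`P`. In the second case, `P` is cut at that position, and the part of `P` after the cut is only
required on a prefix of what remains. -/
theorem not_run (h𝓕 : IsTemporalClass 𝓕) (n : ℕ) :
    ∀ P : List (Step A), P.length ≤ n → (∀ i ∈ P, i.Over 𝓕) →
      ChainDef (compl ⁻¹' 𝓕) (fun p s => ¬ run P FactorRel.eps p s) := by
  have htop := h𝓕.compl.univ
  induction n with
  | zero =>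
    intro P hn _
    obtain rfl : P = [] := by simpa using hn
    refine (true htop).any.congr fun p s => ?_
    cases p <;> simp [run, FactorRel.eps, Step.act]
  | succ n ih =>
    intro P hn hP
    obtain rfl | ⟨P, i, rfl⟩ := P.eq_nil_or_concat'
    · exact ih [] (by simp) (by simp)
    have hPn : P.length ≤ n := by simpa using hn
    have hi := hP i (by simp)
    have hP' : ∀ i ∈ P, i.Over 𝓕 := fun i h => hP i (by simp [h])
    have ihP := ih P hPn hP'
    rw [run_append]
    cases i with
    | test γ =>
      have hγ : γᶜ ∈ compl ⁻¹' 𝓕 := by simpa [Over] using hi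
      refine (ihP.union ((true htop).comp (eps.test hγ))).congr fun p s => ?_
      simp [FactorRel.comp, run, Step.act, FactorRel.eps, imp_iff_not_or]
    | any =>
      refine (eps.union (ihP.comp eps.any)).congr fun p s => ?_
      obtain rfl | ⟨p, a, rfl⟩ := p.eq_nil_or_concat'
      · simp [FactorRel.comp, run, Step.act, FactorRel.eps]
      · simp only [FactorRel.comp, run, List.foldr, Step.act, FactorRel.eps]
        have e : ∀ p₁ p₂ : List A, (p ++ [a] = p₁ ++ p₂ ∧ ∃ b p', p₂ = b :: p' ∧ p' = []) ↔
            p₁ = p ∧ p₂ = [a] := by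
          intro p₁ p₂
          constructor
          · rintro ⟨h, b, _, rfl, rfl⟩
            obtain ⟨rfl, h⟩ := List.append_inj' h rfl
            exact ⟨rfl, by simpa using h.symm⟩
          · rintro ⟨rfl, rfl⟩
            exact ⟨rfl, a, [], rfl, rfl⟩
        simp only [and_left_comm (a := _ ++ _ = _), e]
        simp
    | star β =>
      have hβ : βᶜ ∈ compl ⁻¹' 𝓕 := by simpa [Over] using hi
      have hcut := exists_append_forall h𝓕.compl (splits P)
        (fun c p s => ¬ run c.1 FactorRel.eps p s) (fun c p s => ¬ run c.2 (fun _ _ => True) p s)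
        (fun c hc => ih c.1 ((length_le_of_mem_splits hc).trans hPn)
          fun i h => hP' i ((mem_of_mem_splits hc).1 i h))
        (fun c hc => not_run_true h𝓕 fun i h => hP' i ((mem_of_mem_splits hc).2 i h))
        _ _ ((true htop).comp (eps.any.test hβ)) (true htop)
      refine ((not_run_true h𝓕 hP').union hcut).congr fun p s => ?_
      -- No prefix that goes beyond the cut is described by `P`.
      have hbeyond : ∀ p₁ p₂ : List A,
          (∀ c ∈ splits P, ¬ run c.1 FactorRel.eps p₁ (p₂ ++ s) ∨
            ¬ run c.2 (fun _ _ => True) p₂ s) ↔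
          ∀ r₁ r₂, p₂ = r₁ ++ r₂ → ¬ run P FactorRel.eps (p₁ ++ r₁) (r₂ ++ s) := by
        intro p₁ p₂
        constructor
        · rintro h r₁ r₂ rfl h'
          obtain ⟨c, hc, h1, h2⟩ := (run_eps_append_iff _ _ _ _).1 h'
          refine (h c hc).elim (fun h => h (by simpa using h1)) fun h => h ?_
          rw [run_eq_comp]
          exact ⟨r₁, r₂, rfl, h2, trivial⟩
        · intro h c hc
          rw [← not_and_or]
          rintro ⟨h1, h2⟩
          rw [run_eq_comp] at h2
          obtain ⟨r₁, r₂, rfl, h2, -⟩ := h2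
          exact h r₁ r₂ rfl ((run_eps_append_iff _ _ _ _).2 ⟨c, hc, by simpa using h1, h2⟩)
      simp only [hbeyond]
      constructor
      · intro h
        by_cases hE : run P (fun _ _ => True) p s
        · right
          rcases star_eps_or_exists_last β p s with hall | ⟨q, b, r, rfl, hb, hr⟩
          · rw [run_eq_comp] at hE
            obtain ⟨p₁, p₂, rfl, h1, -⟩ := hE
            exact absurd ⟨p₁, p₂, rfl, h1, star_eps_of_append hall⟩ h
          · refine ⟨q ++ [b], r, by simp, ⟨q, [b], rfl, trivial, ?_, b, [], rfl, rfl⟩, trivial, ?_⟩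
            · simpa using hb
            · rintro r₁ r₂ rfl h'
              exact h ⟨q ++ [b] ++ r₁, r₂, by simp, h', star_eps_of_append hr⟩
        · exact Or.inl hE
      · rintro (hE | ⟨_, p₂, rfl, ⟨q, _, rfl, -, hb, b, _, rfl, rfl⟩, -, h⟩)
          ⟨x₁, x₂, e, h1, h2⟩
        · refine hE ?_
          rw [run_eq_comp]
          exact ⟨x₁, x₂, e, h1, trivial⟩
        · rcases List.append_eq_append_iff.1 e with ⟨r, rfl, rfl⟩ | ⟨r, e', rfl⟩
          · exact h r x₂ rfl h1
          · obtain rfl | ⟨r, a, rfl⟩ := r.eq_nil_or_concat'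
            · simp only [List.append_nil] at e'
              subst e'
              exact h [] p₂ rfl (by simpa using h1)
            · rw [← List.append_assoc] at e'
              obtain ⟨rfl, e'⟩ := List.append_inj' e' rfl
              obtain rfl : b = a := by simpa using e'
              have h2 : FactorRel.star β FactorRel.eps (r ++ b :: p₂) s := by
                have := h2
                rw [List.append_assoc] at this
                exact this
              exact hb (by simpa using (star_eps_cons.1 (star_eps_of_append h2)).1)

theorem not (h𝓕 : IsTemporalClass 𝓕) {R : FactorRel A} (hR : ChainDef 𝓕 R) :
    ChainDef (compl ⁻¹' 𝓕) (fun p s => ¬ R p s) := by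
  obtain ⟨l, hl, hR⟩ := hR
  suffices ChainDef (compl ⁻¹' 𝓕) (fun p s => ∀ P ∈ l, ¬ run P FactorRel.eps p s) from
    this.congr fun p s => by simp [hR]
  clear hR
  induction l with
  | nil => exact (true h𝓕.compl.univ).congr (by simp)
  | cons P l ih =>
    exact ((not_run h𝓕 _ P le_rfl (hl P (by simp))).inter h𝓕.compl
      (ih fun Q h => hl Q (by simp [h]))).congr (by simp)

end ChainDef

/-! ### Languages described by chains -/

theorem FactorRel.star_nil_iff_mem_weakUntil {β : Set (List A)} {R : FactorRel A} {p : List A} :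
    FactorRel.star β R p [] ↔ p ∈ weakUntil β {p | R p []} := by
  induction p with
  | nil => exact Iff.rfl
  | cons a p ih =>
    simp only [cons_mem_weakUntil, FactorRel.star, ih, List.append_nil]
    exact Iff.rfl

/-- A description of the factor that is the whole word gives a language of the class. -/
theorem ChainDef.setOf_nil_mem {𝓕 : Set (Set (List A))} (h𝓕 : IsTemporalClass 𝓕)
    (hnil : {[]} ∈ 𝓕) {R : FactorRel A} (hR : ChainDef 𝓕 R) : {p | R p []} ∈ 𝓕 := by
  have key : ∀ P : List (Step A), (∀ i ∈ P, i.Over 𝓕) → {p | run P FactorRel.eps p []} ∈ 𝓕 := by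
    intro P
    induction P with
    | nil => exact fun _ => hnil
    | cons i P ih =>
      intro hP
      have hi := hP i (by simp)
      have ih := ih fun i h => hP i (by simp [h])
      cases i with
      | test γ =>
        convert h𝓕.inter _ hi _ ih using 1
        ext p
        simp [run_cons, Step.act]
      | any => exact h𝓕.strongNext _ ih
      | star β =>
        convert h𝓕.weakUntil _ hi _ ih using 1
        ext p
        exact star_nil_iff_mem_weakUntil
  obtain ⟨l, hl, hR⟩ := hR
  simp only [hR]
  clear hR
  induction l with
  | nil => simpa using h𝓕.empty
  | cons P l ih =>
    convert h𝓕.union _ (key P (hl P (by simp))) _ (ih fun Q h => hl Q (by simp [h])) using 1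
    ext p
    simp

namespace ChainDef

variable {𝓕 : Set (Set (List A))}

theorem sInter (h𝓕 : IsTemporalClass 𝓕) {T : Set (Set (List A))} (hT : T.Finite)
    (h : ∀ L ∈ T, ChainDef 𝓕 fun p _ => p ∈ L) : ChainDef 𝓕 fun p _ => p ∈ ⋂₀ T := by
  induction T, hT using Set.Finite.induction_on with
  | empty => exact (true h𝓕.univ).congr (by simp)
  | insert _ _ ih =>
    exact ((h _ (Set.mem_insert _ _)).inter h𝓕
      (ih fun L hL => h L (Set.mem_insert_of_mem _ hL))).congr (by simp)

theorem sUnion {T : Set (Set (List A))} (hT : T.Finite)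
    (h : ∀ L ∈ T, ChainDef 𝓕 fun p _ => p ∈ L) : ChainDef 𝓕 fun p _ => p ∈ ⋃₀ T := by
  induction T, hT using Set.Finite.induction_on with
  | empty => exact false.congr (by simp)
  | insert _ _ ih =>
    exact ((h _ (Set.mem_insert _ _)).union
      (ih fun L hL => h L (Set.mem_insert_of_mem _ hL))).congr fun p s => by
        simp only [Set.sUnion_insert, Set.mem_union]

end ChainDef

/-! ### The back-and-forth game on words -/

/-- The back-and-forth game with `n` rounds, in which each round cuts both words at a position: the
letters there have to be related by `ρ`, and the game goes on both before and after the cut. -/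
def BackForth (ρ : A → A → Prop) : ℕ → List A → List A → Prop
  | 0, _, _ => True
  | n + 1, u, v =>
    (∀ u₁ a u₂, u = u₁ ++ a :: u₂ → ∃ v₁ b v₂, v = v₁ ++ b :: v₂ ∧ ρ a b ∧
      BackForth ρ n u₁ v₁ ∧ BackForth ρ n u₂ v₂) ∧
    (∀ v₁ b v₂, v = v₁ ++ b :: v₂ → ∃ u₁ a u₂, u = u₁ ++ a :: u₂ ∧ ρ a b ∧
      BackForth ρ n u₁ v₁ ∧ BackForth ρ n u₂ v₂)

namespace BackForth

variable {ρ : A → A → Prop} {u v : List A}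

theorem swap {n : ℕ} (h : BackForth ρ n u v) : BackForth (fun a b => ρ b a) n v u := by
  induction n generalizing u v with
  | zero => trivial
  | succ n ih =>
    refine ⟨fun v₁ b v₂ e => ?_, fun u₁ a u₂ e => ?_⟩
    · obtain ⟨u₁, a, u₂, e, h0, h1, h2⟩ := h.2 v₁ b v₂ e
      exact ⟨u₁, a, u₂, e, h0, ih h1, ih h2⟩
    · obtain ⟨v₁, b, v₂, e, h0, h1, h2⟩ := h.1 u₁ a u₂ e
      exact ⟨v₁, b, v₂, e, h0, ih h1, ih h2⟩

theorem of_succ {n : ℕ} (h : BackForth ρ (n + 1) u v) : BackForth ρ n u v := by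
  induction n generalizing u v with
  | zero => trivial
  | succ n ih =>
    refine ⟨fun u₁ a u₂ e => ?_, fun v₁ b v₂ e => ?_⟩
    · obtain ⟨v₁, b, v₂, e, h0, h1, h2⟩ := h.1 u₁ a u₂ e
      exact ⟨v₁, b, v₂, e, h0, ih h1, ih h2⟩
    · obtain ⟨u₁, a, u₂, e, h0, h1, h2⟩ := h.2 v₁ b v₂ e
      exact ⟨u₁, a, u₂, e, h0, ih h1, ih h2⟩

theorem mono {m n : ℕ} (hmn : m ≤ n) (h : BackForth ρ n u v) : BackForth ρ m u v := by
  induction hmn with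
  | refl => exact h
  | step _ ih => exact ih h.of_succ

theorem map {B : Type*} {σ : B → B → Prop} (f g : A → B)
    (hfg : ∀ a b, ρ a b → σ (f a) (g b)) {n : ℕ} (h : BackForth ρ n u v) :
    BackForth σ n (u.map f) (v.map g) := by
  induction n generalizing u v with
  | zero => trivial
  | succ n ih =>
    refine ⟨fun u₁ a u₂ e => ?_, fun v₁ b v₂ e => ?_⟩
    · obtain ⟨u₁, _, rfl, rfl, e'⟩ := List.map_eq_append_iff.1 e
      obtain ⟨a, u₂, rfl, rfl, rfl⟩ := List.map_eq_cons_iff.1 e'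
      obtain ⟨v₁, b, v₂, rfl, h0, h1, h2⟩ := h.1 u₁ a u₂ rfl
      exact ⟨_, g b, _, by simp, hfg _ _ h0, ih h1, ih h2⟩
    · obtain ⟨v₁, _, rfl, rfl, e'⟩ := List.map_eq_append_iff.1 e
      obtain ⟨b, v₂, rfl, rfl, rfl⟩ := List.map_eq_cons_iff.1 e'
      obtain ⟨u₁, a, u₂, rfl, h0, h1, h2⟩ := h.2 v₁ b v₂ rfl
      exact ⟨_, f a, _, by simp, hfg _ _ h0, ih h1, ih h2⟩

/-- The game is compatible with concatenation around a letter. -/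
theorem append {n : ℕ} {u₁ u₂ v₁ v₂ : List A} {a b : A} (h1 : BackForth ρ n u₁ v₁) (h0 : ρ a b)
    (h2 : BackForth ρ n u₂ v₂) : BackForth ρ n (u₁ ++ a :: u₂) (v₁ ++ b :: v₂) := by
  -- By symmetry, it is enough to answer the cuts of the first word.
  have forth : ∀ (ρ : A → A → Prop) (n : ℕ), (∀ (u₁ u₂ v₁ v₂ : List A) (a b : A),
      BackForth ρ n u₁ v₁ → ρ a b → BackForth ρ n u₂ v₂ →
        BackForth ρ n (u₁ ++ a :: u₂) (v₁ ++ b :: v₂)) →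
      ∀ (u₁ u₂ v₁ v₂ : List A) (a b : A),
      BackForth ρ (n + 1) u₁ v₁ → ρ a b → BackForth ρ (n + 1) u₂ v₂ →
      ∀ x c y, u₁ ++ a :: u₂ = x ++ c :: y → ∃ x' c' y', v₁ ++ b :: v₂ = x' ++ c' :: y' ∧ ρ c c' ∧
        BackForth ρ n x x' ∧ BackForth ρ n y y' := by
    intro ρ n ih u₁ u₂ v₁ v₂ a b h1 h0 h2 x c y e
    rcases List.append_eq_append_iff.1 e with ⟨r, rfl, e'⟩ | ⟨r, rfl, e'⟩
    · cases r with
      | nil =>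
        obtain ⟨rfl, rfl⟩ := List.cons.inj e'
        exact ⟨v₁, b, v₂, rfl, h0, by simpa using h1.of_succ, h2.of_succ⟩
      | cons d r =>
        obtain ⟨rfl, rfl⟩ := List.cons.inj e'
        obtain ⟨x', c', y', rfl, k0, k1, k2⟩ := h2.1 r c y rfl
        exact ⟨v₁ ++ b :: x', c', y', by simp, k0, ih _ _ _ _ _ _ h1.of_succ h0 k1, k2⟩
    · cases r with
      | nil =>
        obtain ⟨rfl, rfl⟩ := List.cons.inj e'
        exact ⟨v₁, b, v₂, rfl, h0, by simpa using h1.of_succ, h2.of_succ⟩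
      | cons d r =>
        obtain ⟨rfl, rfl⟩ := List.cons.inj e'
        obtain ⟨x', c', y', rfl, k0, k1, k2⟩ := h1.1 x c r rfl
        exact ⟨x', c', y' ++ b :: v₂, by simp, k0, k1, ih _ _ _ _ _ _ k2 h0 h2.of_succ⟩
  induction n generalizing u₁ u₂ v₁ v₂ a b with
  | zero => trivial
  | succ n ih =>
    refine ⟨forth ρ n (fun _ _ _ _ _ _ => ih) _ _ _ _ _ _ h1 h0 h2, fun v₁' b' v₂' e => ?_⟩
    obtain ⟨x, c, y, e, k0, k1, k2⟩ := forth (fun a b => ρ b a) n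
      (fun _ _ _ _ _ _ k1 k0 k2 => (ih k1.swap k0 k2.swap).swap)
      _ _ _ _ _ _ h1.swap h0 h2.swap _ _ _ e
    exact ⟨x, c, y, e, k0, k1.swap, k2.swap⟩

theorem exists_mem {n : ℕ} (h : BackForth ρ (n + 1) u v) {a : A} (ha : a ∈ u) :
    ∃ b ∈ v, ρ a b := by
  obtain ⟨u₁, u₂, rfl⟩ := List.append_of_mem ha
  obtain ⟨v₁, b, v₂, rfl, h0, -⟩ := h.1 u₁ a u₂ rfl
  exact ⟨b, by simp, h0⟩

theorem exists_cons {n : ℕ} {a : A} (h : BackForth ρ (n + 2) (a :: u) v) :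
    ∃ b v', v = b :: v' ∧ ρ a b := by
  obtain ⟨v₁, b, v₂, rfl, h0, h1, -⟩ := h.1 [] a u rfl
  cases v₁ with
  | nil => exact ⟨b, v₂, rfl, h0⟩
  | cons c v₁ =>
    obtain ⟨_, h, -⟩ := h1.swap.exists_mem (List.mem_cons_self (a := c) (l := v₁))
    simp at h

end BackForth

/-- The words with a cut into a word of `K`, a letter above `a` and a word of `L`. -/
def existsCut (ρ : A → A → Prop) (K : Set (List A)) (a : A) (L : Set (List A)) : Set (List A) :=
  {v | ∃ v₁ b v₂, v = v₁ ++ b :: v₂ ∧ v₁ ∈ K ∧ ρ a b ∧ v₂ ∈ L}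

/-- The words each cut of which has its left part in `K`, a letter not below `b` or its right part
in `L`. -/
def forallCut (ρ : A → A → Prop) (K : Set (List A)) (b : A) (L : Set (List A)) : Set (List A) :=
  {u | ∀ u₁ a u₂, u = u₁ ++ a :: u₂ → u₁ ∈ K ∨ ¬ ρ a b ∨ u₂ ∈ L}

namespace ChainDef

variable {𝓕 : Set (Set (List A))} {ρ : A → A → Prop} {K L : Set (List A)}

theorem existsCut {a : A} (ha : {t | ∃ b t', t = b :: t' ∧ ρ a b} ∈ 𝓕)
    (hK : ChainDef 𝓕 fun p _ => p ∈ K) (hL : ChainDef 𝓕 fun p _ => p ∈ L) :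
    ChainDef 𝓕 fun p _ => p ∈ existsCut ρ K a L := by
  refine (hK.comp (hL.any.test ha)).congr fun p s => ?_
  constructor
  · rintro ⟨v₁, b, v₂, rfl, h1, h0, h2⟩
    exact ⟨v₁, b :: v₂, rfl, h1, ⟨b, _, rfl, h0⟩, b, v₂, rfl, h2⟩
  · rintro ⟨v₁, _, rfl, h1, ⟨c, t, e, h0⟩, b, v₂, rfl, h2⟩
    obtain ⟨rfl, -⟩ := List.cons.inj e
    exact ⟨v₁, b, v₂, rfl, h1, h0, h2⟩

theorem forallCut (h𝓕 : IsTemporalClass 𝓕) {b : A}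
    (hb : {t | ∃ a t', t = a :: t' ∧ ρ a b}ᶜ ∈ 𝓕)
    (hK : ChainDef 𝓕 fun p _ => p ∈ K) (hL : ChainDef 𝓕 fun p _ => p ∈ L) :
    ChainDef 𝓕 fun p _ => p ∈ forallCut ρ K b L := by
  have h := ((existsCut (ρ := fun b a => ρ a b) (K := Kᶜ) (L := Lᶜ) (a := b)
    (𝓕 := compl ⁻¹' 𝓕) hb (hK.not h𝓕) (hL.not h𝓕)).not h𝓕.compl)
  rw [compl_preimage_compl] at h
  refine h.congr fun p s => ?_
  simp only [_root_.existsCut, _root_.forallCut, Set.mem_ofPred_eq, Set.mem_compl_iff]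
  push Not
  refine forall_congr' fun p₁ => forall_congr' fun a => forall_congr' fun p₂ => ?_
  tauto

/-- Finitely many languages described by chains decide the back-and-forth game. -/
theorem exists_finite_backForth [Finite A] (h𝓕 : IsTemporalClass 𝓕) (hrefl : ∀ a, ρ a a)
    (hρ : ∀ a, {t | ∃ b t', t = b :: t' ∧ ρ a b} ∈ 𝓕)
    (hρ' : ∀ b, {t | ∃ a t', t = a :: t' ∧ ρ a b}ᶜ ∈ 𝓕) (n : ℕ) :
    ∃ 𝓢 : Set (Set (List A)), 𝓢.Finite ∧ (∀ L ∈ 𝓢, ChainDef 𝓕 fun p _ => p ∈ L) ∧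
      ∀ u v, (∀ L ∈ 𝓢, u ∈ L → v ∈ L) → BackForth ρ n u v := by
  induction n with
  | zero => exact ⟨∅, Set.finite_empty, by simp, fun _ _ _ => trivial⟩
  | succ n ih =>
    obtain ⟨𝓢, hfin, hdef, h𝓢⟩ := ih
    let I : Set (Set (Set (List A)) × A × Set (Set (List A))) := 𝓢.powerset ×ˢ Set.univ ×ˢ 𝓢.powerset
    have hI : I.Finite := hfin.powerset.prod (Set.finite_univ.prod hfin.powerset)
    refine ⟨(fun T => _root_.existsCut ρ (⋂₀ T.1) T.2.1 (⋂₀ T.2.2)) '' I ∪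
      (fun T => _root_.forallCut ρ (⋃₀ T.1) T.2.1 (⋃₀ T.2.2)) '' I,
      (hI.image _).union (hI.image _), ?_, ?_⟩
    · rintro _ (⟨T, hT, rfl⟩ | ⟨T, hT, rfl⟩)
      · exact existsCut (hρ _) (sInter h𝓕 (hfin.subset hT.1) fun L hL => hdef L (hT.1 hL))
          (sInter h𝓕 (hfin.subset hT.2.2) fun L hL => hdef L (hT.2.2 hL))
      · exact forallCut h𝓕 (hρ' _) (sUnion (hfin.subset hT.1) fun L hL => hdef L (hT.1 hL))
          (sUnion (hfin.subset hT.2.2) fun L hL => hdef L (hT.2.2 hL))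
    · intro u v huv
      constructor
      · rintro u₁ a u₂ rfl
        obtain ⟨v₁, b, v₂, e, h1, h0, h2⟩ := huv _
          (Or.inl ⟨⟨{L ∈ 𝓢 | u₁ ∈ L}, a, {L ∈ 𝓢 | u₂ ∈ L}⟩,
            ⟨fun L h => h.1, trivial, fun L h => h.1⟩, rfl⟩)
          ⟨u₁, a, u₂, rfl, fun L h => h.2, hrefl a, fun L h => h.2⟩
        exact ⟨v₁, b, v₂, e, h0, h𝓢 _ _ fun L hL h => h1 L ⟨hL, h⟩,
          h𝓢 _ _ fun L hL h => h2 L ⟨hL, h⟩⟩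
      · rintro v₁ b v₂ rfl
        by_contra hno
        push Not at hno
        -- The languages that do not contain the parts of the second word separate it from the first.
        have hv := huv _
          (Or.inr ⟨⟨{L ∈ 𝓢 | v₁ ∉ L}, b, {L ∈ 𝓢 | v₂ ∉ L}⟩,
            ⟨fun L h => h.1, trivial, fun L h => h.1⟩, rfl⟩)
          (by
            intro u₁ a u₂ e
            by_contra hcon
            push Not at hcon
            obtain ⟨h1, h0, h2⟩ := hcon
            refine hno u₁ a u₂ e h0 (h𝓢 _ _ fun L hL h => ?_) (h𝓢 _ _ fun L hL h => ?_)
            · by_contra h'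
              exact h1 ⟨L, ⟨hL, h'⟩, h⟩
            · by_contra h'
              exact h2 ⟨L, ⟨hL, h'⟩, h⟩)
        rcases hv v₁ b v₂ rfl with ⟨L, hL, h⟩ | h | ⟨L, hL, h⟩
        · exact hL.2 h
        · exact h (hrefl b)
        · exact hL.2 h

/-- A language that the game preserves belongs to the class. -/
theorem mem_of_backForth [Finite A] (h𝓕 : IsTemporalClass 𝓕) (hnil : {[]} ∈ 𝓕)
    (hrefl : ∀ a, ρ a a)
    (hρ : ∀ a, {t | ∃ b t', t = b :: t' ∧ ρ a b} ∈ 𝓕)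
    (hρ' : ∀ b, {t | ∃ a t', t = a :: t' ∧ ρ a b}ᶜ ∈ 𝓕) (n : ℕ)
    (hL : ∀ u v, BackForth ρ n u v → u ∈ L → v ∈ L) : L ∈ 𝓕 := by
  obtain ⟨𝓢, hfin, hdef, h𝓢⟩ := exists_finite_backForth h𝓕 hrefl hρ hρ' n
  let T : Set (Set (List A)) := (fun u => ⋂₀ {M ∈ 𝓢 | u ∈ M}) '' L
  have hTL : ⋃₀ T = L := by
    ext v
    constructor
    · rintro ⟨_, ⟨u, hu, rfl⟩, hv⟩
      exact hL u v (h𝓢 u v fun M hM h => hv M ⟨hM, h⟩) hu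
    · exact fun hv => ⟨_, ⟨v, hv, rfl⟩, fun M hM => hM.2⟩
  have hT : T.Finite := by
    refine (hfin.powerset.image fun T => ⋂₀ T).subset ?_
    rintro _ ⟨u, -, rfl⟩
    exact ⟨_, fun M hM => hM.1, rfl⟩
  rw [← hTL]
  refine setOf_nil_mem h𝓕 hnil (R := fun p _ => p ∈ ⋃₀ T) (sUnion hT ?_)
  rintro _ ⟨u, -, rfl⟩
  exact sInter h𝓕 (hfin.subset fun M hM => hM.1) fun M hM => hdef M hM.1

end ChainDef

end Chains

/-! ### First-order formulas and the game -/

/-- The word `u` where each letter is paired with the set of variables that `ν` puts at this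
position. -/
def markVars {α : Type*} (u : List (Set α)) (ν : ℕ → ℕ) : List (Set α × Set ℕ) :=
  u.mapIdx fun i a => (a, {x | ν x = i})

/-- The order on letters for which first-order formulas with marked variables are monotone. -/
def markLE {α : Type*} (a b : Set α × Set ℕ) : Prop := a.1 ⊆ b.1 ∧ a.2 = b.2

section markVars

variable {α : Type*} {u v : List (Set α)} {ν ν' : ℕ → ℕ}

@[simp] theorem length_markVars : (markVars u ν).length = u.length := by simp [markVars]

@[simp] theorem getElem_markVars {i : ℕ} (h : i < (markVars u ν).length) :
    (markVars u ν)[i] = (u[i]'(by simpa using h), {x | ν x = i}) := by simp [markVars]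

theorem mem_take_markVars {i : ℕ} {c : Set α × Set ℕ} (h : c ∈ (markVars u ν).take i) :
    ∃ k < i, c.2 = {x | ν x = k} := by
  obtain ⟨k, hk, rfl⟩ := List.mem_iff_getElem.1 h
  exact ⟨k, by simp at hk; omega, by simp⟩

theorem mem_drop_markVars {i : ℕ} {c : Set α × Set ℕ} (h : c ∈ (markVars u ν).drop i) :
    ∃ k, i ≤ k ∧ c.2 = {x | ν x = k} := by
  obtain ⟨k, hk, rfl⟩ := List.mem_iff_getElem.1 h
  exact ⟨i + k, by omega, by simp⟩

theorem exists_mem_take_markVars {i x : ℕ} (h : ν x < i) (hx : ν x < u.length) :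
    ∃ c ∈ (markVars u ν).take i, x ∈ c.2 :=
  ⟨(u[ν x], {y | ν y = ν x}), List.mem_iff_getElem.2 ⟨ν x, by simp [h, hx], by simp⟩, rfl⟩

theorem exists_mem_drop_markVars {i x : ℕ} (h : i ≤ ν x) (hx : ν x < u.length) :
    ∃ c ∈ (markVars u ν).drop i, x ∈ c.2 :=
  ⟨(u[ν x], {y | ν y = ν x}),
    List.mem_iff_getElem.2 ⟨ν x - i, by simp; omega, by simp [Nat.add_sub_cancel' h]⟩, rfl⟩

/-- A variable is moved to another position by deleting all its marks and adding one. -/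
theorem markVars_update {i : ℕ} (hi : i < u.length) (x : ℕ) :
    markVars u (Function.update ν x i) =
      ((markVars u ν).take i).map (fun c => (c.1, c.2 \ {x})) ++
        (u[i], insert x {y | ν y = i}) ::
          ((markVars u ν).drop (i + 1)).map (fun c => (c.1, c.2 \ {x})) := by
  have hset : ∀ k, k ≠ i → {y | Function.update ν x i y = k} = {y | ν y = k} \ {x} := by
    intro k hk
    ext y
    by_cases hy : y = x
    · simp [hy, hk.symm]
    · simp [hy]
  refine List.ext_getElem (by simp; omega) fun k h1 h2 => ?_
  rcases lt_trichotomy k i with hk | rfl | hk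
  · rw [List.getElem_append_left (by simp at h1 ⊢; omega)]
    simp [hset k hk.ne]
  · rw [List.getElem_append_right (by simp)]
    have : {y | Function.update ν x k y = k} = insert x {y | ν y = k} := by
      ext y
      by_cases hy : y = x <;> simp [hy]
    simp [this, Nat.min_eq_left hi.le]
  · obtain ⟨m, rfl⟩ := Nat.exists_eq_add_of_lt hk
    rw [List.getElem_append_right (by simp; omega)]
    simp [hset _ hk.ne', Nat.min_eq_left hi.le, show i + m + 1 - i = m + 1 by omega,
      show i + 1 + m = i + m + 1 by omega]

variable {ρ : Set α × Set ℕ → Set α × Set ℕ → Prop}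

theorem BackForth.exists_cut_markVars {n : ℕ}
    (h : BackForth ρ (n + 1) (markVars u ν) (markVars v ν')) {i : ℕ} (hi : i < u.length) :
    ∃ (j : ℕ) (hj : j < v.length), ρ (u[i], {x | ν x = i}) (v[j], {x | ν' x = j}) ∧
      BackForth ρ n ((markVars u ν).take i) ((markVars v ν').take j) ∧
      BackForth ρ n ((markVars u ν).drop (i + 1)) ((markVars v ν').drop (j + 1)) := by
  have hi' : i < (markVars u ν).length := by simpa using hi
  have e := List.take_append_drop i (markVars u ν)
  rw [← List.cons_getElem_drop_succ (h := hi'), getElem_markVars] at e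
  obtain ⟨v₁, b, v₂, hv, h0, h1, h2⟩ := h.1 _ _ _ e.symm
  have hlen : v₁.length < (markVars v ν').length := by simp [hv]
  have hb : (markVars v ν')[v₁.length] = b := by simp [hv]
  refine ⟨v₁.length, by simpa using hlen, ?_, ?_, ?_⟩
  · rw [getElem_markVars] at hb
    rwa [hb]
  · rwa [hv, List.take_left]
  · rw [hv]
    simpa [List.drop_append, List.drop_eq_nil_of_le] using h2

/-- The game with three rounds preserves the relative positions of the marked variables. -/
theorem BackForth.order_markVars (hρ : ∀ a b, ρ a b → a.2 = b.2)
    (h : BackForth ρ 3 (markVars u ν) (markVars v ν')) {x y : ℕ}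
    (hx : ν x < u.length) (hy : ν y < u.length) :
    (ν y < ν x → ν' y < ν' x) ∧ (ν y = ν x → ν' y = ν' x) ∧ (ν x < ν y → ν' x < ν' y) ∧
      (ν y = ν x + 1 → ν' y = ν' x + 1) := by
  obtain ⟨j, hj, h0, h1, h2⟩ := h.exists_cut_markVars hx
  have h0 : {y | ν y = ν x} = {y | ν' y = j} := hρ _ _ h0
  have hxj : ν' x = j := by
    have : x ∈ {y | ν y = ν x} := rfl
    rwa [h0] at this
  refine ⟨fun hlt => ?_, fun heq => ?_, fun hlt => ?_, fun heq => ?_⟩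
  · obtain ⟨c, hc, hyc⟩ := exists_mem_take_markVars hlt hy
    obtain ⟨d, hd, hcd⟩ := h1.exists_mem hc
    obtain ⟨k, hk, hdk⟩ := mem_take_markVars hd
    rw [hρ _ _ hcd, hdk] at hyc
    rw [show ν' y = k from hyc, hxj]
    exact hk
  · have : y ∈ {y | ν y = ν x} := heq
    rw [h0] at this
    rw [hxj]
    exact this
  · obtain ⟨c, hc, hyc⟩ := exists_mem_drop_markVars (Nat.succ_le_of_lt hlt) hy
    obtain ⟨d, hd, hcd⟩ := h2.exists_mem hc
    obtain ⟨k, hk, hdk⟩ := mem_drop_markVars hd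
    rw [hρ _ _ hcd, hdk] at hyc
    rw [show ν' y = k from hyc, hxj]
    exact hk
  · have hy' : ν x + 1 < (markVars u ν).length := by simpa [← heq] using hy
    rw [← List.cons_getElem_drop_succ (h := hy')] at h2
    obtain ⟨d, v', hd, hcd⟩ := h2.exists_cons
    have hlen : j + 1 < (markVars v ν').length := by
      by_contra hcon
      rw [List.drop_eq_nil_of_le (not_lt.1 hcon)] at hd
      simp at hd
    rw [← List.cons_getElem_drop_succ (h := hlen)] at hd
    have hd' := (List.cons.inj hd).1
    rw [← hd', getElem_markVars, getElem_markVars] at hcd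
    have hyc : y ∈ {y | ν y = ν x + 1} := heq
    rw [show {y | ν y = ν x + 1} = {y | ν' y = j + 1} from hρ _ _ hcd] at hyc
    rw [hxj]
    exact hyc

/-- Moving a variable to the positions cut in a round of the game. -/
theorem BackForth.update_markVars {n i j : ℕ} (hi : i < u.length) (hj : j < v.length)
    (h0 : markLE (u[i], {x | ν x = i}) (v[j], {x | ν' x = j}))
    (h1 : BackForth markLE n ((markVars u ν).take i) ((markVars v ν').take j))
    (h2 : BackForth markLE n ((markVars u ν).drop (i + 1)) ((markVars v ν').drop (j + 1)))
    (x : ℕ) : BackForth markLE n (markVars u (Function.update ν x i))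
      (markVars v (Function.update ν' x j)) := by
  have herase : ∀ c d : Set α × Set ℕ, markLE c d → markLE (c.1, c.2 \ {x}) (d.1, d.2 \ {x}) :=
    fun c d h => ⟨h.1, by rw [h.2]⟩
  rw [markVars_update hi, markVars_update hj]
  exact (h1.map _ _ herase).append
    ⟨h0.1, congrArg (insert x) h0.2⟩ (h2.map _ _ herase)

end markVars

namespace FOPlus

variable {B : Set BinPred} {α : Type*}

/-- The quantifier depth of a formula. -/
def depth : FOPlus B α → ℕ
  | bot => 0
  | top => 0
  | rel _ _ _ _ => 0
  | letter _ _ => 0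
  | and φ ψ => max φ.depth ψ.depth
  | or φ ψ => max φ.depth ψ.depth
  | ex _ φ => φ.depth + 1
  | all _ φ => φ.depth + 1

/-- Each quantifier takes one round of the game, and the atomic formulas the last three rounds. -/
theorem sat_of_backForth {u v : List (Set α)} (φ : FOPlus B α) {n : ℕ} (hn : φ.depth + 3 ≤ n)
    {ν ν' : ℕ → ℕ} (hν : ∀ x ∈ φ.freeVars, ν x < u.length)
    (hν' : ∀ x ∈ φ.freeVars, ν' x < v.length)
    (h : BackForth markLE n (markVars u ν) (markVars v ν')) (hφ : φ.Sat u ν) : φ.Sat v ν' := by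
  have update_lt : ∀ (s : Finset ℕ) (w : List (Set α)) (μ : ℕ → ℕ) (x i : ℕ), i < w.length →
      (∀ y ∈ s.erase x, μ y < w.length) → ∀ y ∈ s, Function.update μ x i y < w.length := by
    intro s w μ x i hi h y hy
    by_cases hyx : y = x
    · simpa [hyx] using hi
    · simpa [hyx] using h y (Finset.mem_erase.2 ⟨hyx, hy⟩)
  induction φ generalizing n ν ν' with
  | bot => exact hφ
  | top => trivial
  | rel b hb x y =>
    have h3 := h.mono (show 3 ≤ n by simp only [depth] at hn; omega)
    obtain ⟨a1, a2, a3, a4⟩ := h3.order_markVars (fun _ _ h => h.2)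
      (hν x (by simp [freeVars])) (hν y (by simp [freeVars]))
    obtain ⟨-, -, -, b4⟩ := h3.swap.order_markVars (fun _ _ h => h.2.symm)
      (hν' x (by simp [freeVars])) (hν' y (by simp [freeVars]))
    cases b <;> simp only [Sat, BinPred.Holds] at hφ ⊢ <;> omega
  | letter a x =>
    obtain ⟨hx, ha⟩ := hφ
    obtain ⟨n, rfl⟩ := Nat.exists_eq_add_of_le' (show 1 ≤ n by simp only [depth] at hn; omega)
    obtain ⟨j, hj, h0, -⟩ := h.exists_cut_markVars hx
    have hxj : ν' x = j := by
      have : x ∈ {y | ν y = ν x} := rfl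
      rwa [show {y | ν y = ν x} = {y | ν' y = j} from h0.2] at this
    subst hxj
    exact ⟨hj, h0.1 ha⟩
  | and φ ψ ih1 ih2 =>
    simp only [depth] at hn
    exact ⟨ih1 (by omega) (fun x hx => hν x (by simp [freeVars, hx]))
        (fun x hx => hν' x (by simp [freeVars, hx])) h hφ.1,
      ih2 (by omega) (fun x hx => hν x (by simp [freeVars, hx]))
        (fun x hx => hν' x (by simp [freeVars, hx])) h hφ.2⟩
  | or φ ψ ih1 ih2 =>
    simp only [depth] at hn
    exact hφ.imp (ih1 (by omega) (fun x hx => hν x (by simp [freeVars, hx]))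
        (fun x hx => hν' x (by simp [freeVars, hx])) h)
      (ih2 (by omega) (fun x hx => hν x (by simp [freeVars, hx]))
        (fun x hx => hν' x (by simp [freeVars, hx])) h)
  | ex x φ ih =>
    simp only [depth] at hn
    obtain ⟨n, rfl⟩ := Nat.exists_eq_add_of_le' (show 1 ≤ n by omega)
    obtain ⟨i, hi, hφ⟩ := hφ
    obtain ⟨j, hj, h0, h1, h2⟩ := h.exists_cut_markVars hi
    exact ⟨j, hj, ih (by omega) (update_lt _ u ν x i hi hν) (update_lt _ v ν' x j hj hν')
      (BackForth.update_markVars hi hj h0 h1 h2 x) hφ⟩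
  | all x φ ih =>
    simp only [depth] at hn
    obtain ⟨n, rfl⟩ := Nat.exists_eq_add_of_le' (show 1 ≤ n by omega)
    intro j hj
    obtain ⟨i, hi, h0, h1, h2⟩ := h.swap.exists_cut_markVars hj
    exact ih (by omega) (update_lt _ u ν x i hi hν) (update_lt _ v ν' x j hj hν')
      (BackForth.update_markVars hi hj h0 h1.swap h2.swap x) (hφ i hi)

theorem mem_language_of_backForth {φ : FOPlus B α} (hφ : φ.Closed) {u v : List (Set α)}
    (h : BackForth (· ⊆ ·) (φ.depth + 3) u v) (hu : u ∈ φ.language) : v ∈ φ.language := by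
  -- Assignments out of range mark no position.
  have hmark : ∀ w : List (Set α), markVars w (fun _ => w.length) = w.map fun a => (a, ∅) := by
    intro w
    refine List.ext_getElem (by simp) fun i h1 h2 => ?_
    have : w.length ≠ i := by simp at h1; omega
    simp [this]
  have hfree : ∀ {x}, x ∉ φ.freeVars := by simp [show φ.freeVars = ∅ from hφ]
  refine (sat_congr v φ _ (fun _ => v.length) fun x hx => absurd hx hfree).2 ?_
  refine sat_of_backForth φ le_rfl (ν := fun _ => u.length) (fun x hx => absurd hx hfree)
    (fun x hx => absurd hx hfree) ?_
    ((sat_congr u φ _ (fun _ => u.length) fun x hx => absurd hx hfree).1 hu)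
  rw [hmark, hmark]
  exact h.map _ _ fun a b hab => ⟨hab, rfl⟩

end FOPlus

/-! ### Languages of positive temporal formulas -/

namespace LTLPlus

variable {α : Type*}

/-- A formula with truth value `p` on all words. -/
noncomputable def const (p : Prop) : LTLPlus α := by
  classical exact if p then top else bot

@[simp] theorem sat_const {p : Prop} {u : List (Set α)} : (const p : LTLPlus α).Sat u ↔ p := by
  by_cases h : p <;> simp [const, h, Sat]

theorem sat_letter_cons {c : α} {a : Set α} {t : List (Set α)} :
    (letter c).Sat (a :: t) ↔ c ∈ a := by simp [Sat]

theorem not_sat_untl_nil {φ ψ : LTLPlus α} : ¬ (untl φ ψ).Sat [] := by simp [Sat]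

theorem sat_untl_cons {φ ψ : LTLPlus α} {a : Set α} {t : List (Set α)} :
    (untl φ ψ).Sat (a :: t) ↔ ψ.Sat (a :: t) ∨ (φ.Sat (a :: t) ∧ (untl φ ψ).Sat t) := by
  simp only [Sat]
  constructor
  · rintro ⟨i, hi, h1, h2⟩
    cases i with
    | zero => exact Or.inl h1
    | succ i =>
      exact Or.inr ⟨h2 0 (by omega), i, by simpa using hi, h1, fun j hj => h2 (j + 1) (by omega)⟩
  · rintro (h | ⟨h, i, hi, h1, h2⟩)
    · exact ⟨0, by simp, h, by simp⟩
    · refine ⟨i + 1, by simpa using hi, h1, fun j hj => ?_⟩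
      cases j with
      | zero => exact h
      | succ j => exact h2 j (by omega)

theorem sat_release_nil {φ ψ : LTLPlus α} : (release φ ψ).Sat [] := by simp [Sat]

theorem sat_release_cons {φ ψ : LTLPlus α} {a : Set α} {t : List (Set α)} :
    (release φ ψ).Sat (a :: t) ↔ ψ.Sat (a :: t) ∧ (φ.Sat (a :: t) ∨ (release φ ψ).Sat t) := by
  have huntl : ∀ w : List (Set α), (release φ ψ).Sat w ↔
      (untl ψ (and ψ φ)).Sat w ∨ ∀ i < w.length, ψ.Sat (w.drop i) := fun w => Iff.rfl
  have hall : (∀ i < (a :: t).length, ψ.Sat ((a :: t).drop i)) ↔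
      ψ.Sat (a :: t) ∧ ∀ i < t.length, ψ.Sat (t.drop i) := by
    constructor
    · exact fun h => ⟨h 0 (by simp), fun i hi => h (i + 1) (by simpa using hi)⟩
    · rintro ⟨h0, h⟩ (_ | i) hi
      · exact h0
      · exact h i (by simpa using hi)
  have hand : (and ψ φ).Sat (a :: t) ↔ ψ.Sat (a :: t) ∧ φ.Sat (a :: t) := Iff.rfl
  rw [huntl, huntl, sat_untl_cons, hall, hand]
  tauto

/-- The languages of positive temporal formulas, as sets of words. -/
def languages (α : Type*) : Set (Set (List (Set α))) :=
  {L | ∃ φ : LTLPlus α, ∀ u, φ.Sat u ↔ u ∈ L}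

/-- Positive temporal formulas describe a temporal class. The operators of the formulas only look at
nonempty suffixes, so that the truth value at the empty word has to be added by hand. -/
theorem isTemporalClass_languages : IsTemporalClass (languages α) where
  empty := ⟨bot, fun _ => Iff.rfl⟩
  univ := ⟨top, fun _ => Iff.rfl⟩
  union := by
    rintro L ⟨φ, hφ⟩ M ⟨ψ, hψ⟩
    exact ⟨or φ ψ, fun u => or_congr (hφ u) (hψ u)⟩
  inter := by
    rintro L ⟨φ, hφ⟩ M ⟨ψ, hψ⟩
    exact ⟨and φ ψ, fun u => and_congr (hφ u) (hψ u)⟩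
  strongNext := by
    rintro L ⟨φ, hφ⟩
    refine ⟨and (untl top top) (next φ), fun t => ?_⟩
    cases t with
    | nil => simp [Sat, strongNext]
    | cons a t => simp [Sat, strongNext, hφ, show ∃ i, i ≤ t.length from ⟨0, by simp⟩]
  strongNext_dual := by
    rintro L ⟨φ, hφ⟩
    refine ⟨or (release bot bot) (next φ), fun t => ?_⟩
    cases t with
    | nil => simp [Sat, strongNext]
    | cons a t =>
      simp [Sat, strongNext, hφ, show ¬ ∀ i, t.length < i from fun h => absurd (h 0) (by simp)]
  weakUntil := by
    rintro L ⟨φ, hφ⟩ M ⟨ψ, hψ⟩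
    refine ⟨or (untl φ ψ) (and (release bot φ) (const ([] ∈ M))), fun t => ?_⟩
    change (untl φ ψ).Sat t ∨ ((release bot φ).Sat t ∧ (const ([] ∈ M)).Sat t) ↔ _
    rw [sat_const]
    induction t with
    | nil => simp [not_sat_untl_nil, sat_release_nil, nil_mem_weakUntil]
    | cons a t ih =>
      have hbot : (bot : LTLPlus α).Sat (a :: t) ↔ False := Iff.rfl
      rw [cons_mem_weakUntil, ← ih, sat_untl_cons, sat_release_cons, hφ, hψ, hbot]
      tauto
  weakUntil_dual := by
    rintro L ⟨φ, hφ⟩ M ⟨ψ, hψ⟩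
    refine ⟨and (release φ ψ) (or (untl top φ) (const ([] ∈ M))), fun t => ?_⟩
    change (release φ ψ).Sat t ∧ ((untl top φ).Sat t ∨ (const ([] ∈ M)).Sat t) ↔ _
    rw [sat_const]
    induction t with
    | nil => simp [not_sat_untl_nil, sat_release_nil, nil_mem_weakUntil]
    | cons a t ih =>
      have htop : (top : LTLPlus α).Sat (a :: t) ↔ True := Iff.rfl
      rw [Set.mem_compl_iff] at ih ⊢
      rw [cons_mem_weakUntil, sat_untl_cons, sat_release_cons, hφ, hψ, htop, Set.mem_compl_iff,
        Set.mem_compl_iff]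
      tauto

theorem singleton_nil_mem_languages : {[]} ∈ languages α := by
  refine ⟨release bot bot, fun t => ?_⟩
  cases t with
  | nil => simp [sat_release_nil]
  | cons a t => simp [sat_release_cons, show ¬ (bot : LTLPlus α).Sat (a :: t) from id]

theorem setOf_sat_letter_mem_languages (c : α) : {u | (letter c).Sat u} ∈ languages α :=
  ⟨letter c, fun _ => Iff.rfl⟩

theorem cons_superset_mem_languages [Finite α] (a : Set α) :
    {t | ∃ b t', t = b :: t' ∧ a ⊆ b} ∈ languages α := by
  have h : {u | ∀ c ∈ a, (letter c).Sat u} ∈ languages α := by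
    induction a, a.toFinite using Set.Finite.induction_on with
    | empty => simpa using isTemporalClass_languages.univ
    | @insert c _ _ _ ih =>
      convert isTemporalClass_languages.inter _ (setOf_sat_letter_mem_languages c) _ ih using 1
      ext u
      simp
  convert isTemporalClass_languages.inter _ h _
    (isTemporalClass_languages.strongNext _ isTemporalClass_languages.univ) using 1
  ext t
  cases t with
  | nil => simp [strongNext]
  | cons b t => simp [strongNext, sat_letter_cons, Set.subset_def]

theorem cons_subset_compl_mem_languages [Finite α] (b : Set α) :
    {t | ∃ a t', t = a :: t' ∧ a ⊆ b}ᶜ ∈ languages α := by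
  have h : ∀ s : Set α, {u | ∃ c ∈ s, (letter c).Sat u} ∈ languages α := by
    intro s
    induction s, s.toFinite using Set.Finite.induction_on with
    | empty => simpa using isTemporalClass_languages.empty
    | @insert c _ _ _ ih =>
      convert isTemporalClass_languages.union _ (setOf_sat_letter_mem_languages c) _ ih using 1
      ext u
      simp
  convert isTemporalClass_languages.union _ (h bᶜ) _ singleton_nil_mem_languages using 1
  ext t
  cases t with
  | nil => simp
  | cons a t => simp [sat_letter_cons, Set.not_subset, and_comm]

end LTLPlus

/-- Every language described by a positive first-order formula is described by a positive temporal
formula. -/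
theorem foPlusLanguages_subset {α : Type*} [Finite α] (B : Set BinPred) :
    foPlusLanguages B α ⊆ ltlPlusLanguages α := by
  rintro _ ⟨φ, hφ, rfl⟩
  obtain ⟨ψ, hψ⟩ := ChainDef.mem_of_backForth (ρ := (· ⊆ ·)) (L := φ.language)
    LTLPlus.isTemporalClass_languages LTLPlus.singleton_nil_mem_languages (fun a => subset_rfl)
    LTLPlus.cons_superset_mem_languages LTLPlus.cons_subset_compl_mem_languages (φ.depth + 3)
    fun u v h hu => FOPlus.mem_language_of_backForth hφ h hu
  exact ⟨ψ, Set.ext hψ⟩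

/-! ### The standard translation of temporal formulas, with three variables -/

namespace LTLPlus

variable {α : Type*} {B : Set BinPred}

/-- The formula with free variable `x` that expresses `φ` at position `x`, written with the three
variables `x`, `y`, `z`. At the last position, the formula below `next` is evaluated on the empty
word, which no position represents, so its truth value there is put in. -/
noncomputable def toFO (hle : BinPred.le ∈ B) (hlt : BinPred.lt ∈ B) :
    LTLPlus α → ℕ → ℕ → ℕ → FOPlus B α
  | bot, _, _, _ => .bot
  | top, _, _, _ => .top
  | letter a, x, _, _ => .letter a x
  | and φ ψ, x, y, z => .and (toFO hle hlt φ x y z) (toFO hle hlt ψ x y z)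
  | or φ ψ, x, y, z => .or (toFO hle hlt φ x y z) (toFO hle hlt ψ x y z)
  | next φ, x, y, z =>
    .or (.ex y (.and (.and (.rel .lt hlt x y) (.all z (.or (.rel .le hle z x) (.rel .le hle y z))))
        (toFO hle hlt φ y x z)))
      (.and (.all y (.rel .le hle y x)) (open Classical in if φ.Sat [] then .top else .bot))
  | untl φ ψ, x, y, z =>
    .ex y (.and (.and (.rel .le hle x y) (toFO hle hlt ψ y x z))
      (.all z (.or (.or (.rel .lt hlt z x) (.rel .le hle y z)) (toFO hle hlt φ z x y))))
  | release φ ψ, x, y, z =>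
    .or (.ex y (.and (.and (.rel .le hle x y)
          (.and (toFO hle hlt ψ y x z) (toFO hle hlt φ y x z)))
        (.all z (.or (.or (.rel .lt hlt z x) (.rel .le hle y z)) (toFO hle hlt ψ z x y)))))
      (.all y (.or (.rel .lt hlt y x) (toFO hle hlt ψ y x z)))

variable (hle : BinPred.le ∈ B) (hlt : BinPred.lt ∈ B)

theorem vars_toFO (φ : LTLPlus α) (x y z : ℕ) : (toFO hle hlt φ x y z).vars ⊆ {x, y, z} := by
  induction φ generalizing x y z with
  | bot => simp [toFO, FOPlus.vars]
  | top => simp [toFO, FOPlus.vars]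
  | letter a => simp [toFO, FOPlus.vars]
  | and φ ψ ih1 ih2 => exact Finset.union_subset (ih1 x y z) (ih2 x y z)
  | or φ ψ ih1 ih2 => exact Finset.union_subset (ih1 x y z) (ih2 x y z)
  | next φ ih =>
    intro w hw
    have h1 := @ih y x z w
    by_cases he : φ.Sat [] <;>
    · simp only [toFO, FOPlus.vars, he, if_true, if_false, Finset.mem_union, Finset.mem_insert,
        Finset.mem_singleton, Finset.notMem_empty] at hw h1 ⊢
      grind
  | untl φ ψ ih1 ih2 =>
    intro w hw
    have h1 := @ih1 z x y w
    have h2 := @ih2 y x z w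
    simp only [toFO, FOPlus.vars, Finset.mem_union, Finset.mem_insert,
      Finset.mem_singleton] at hw h1 h2 ⊢
    grind
  | release φ ψ ih1 ih2 =>
    intro w hw
    have h1 := @ih1 y x z w
    have h2 := @ih2 y x z w
    have h3 := @ih2 z x y w
    simp only [toFO, FOPlus.vars, Finset.mem_union, Finset.mem_insert,
      Finset.mem_singleton] at hw h1 h2 h3 ⊢
    grind

theorem freeVars_toFO (φ : LTLPlus α) (x y z : ℕ) :
    (toFO hle hlt φ x y z).freeVars ⊆ {x} := by
  induction φ generalizing x y z with
  | bot => simp [toFO, FOPlus.freeVars]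
  | top => simp [toFO, FOPlus.freeVars]
  | letter a => simp [toFO, FOPlus.freeVars]
  | and φ ψ ih1 ih2 => exact Finset.union_subset (ih1 x y z) (ih2 x y z)
  | or φ ψ ih1 ih2 => exact Finset.union_subset (ih1 x y z) (ih2 x y z)
  | next φ ih =>
    intro w hw
    have h1 := @ih y x z w
    by_cases he : φ.Sat [] <;>
    · simp only [toFO, FOPlus.freeVars, he, if_true, if_false, Finset.mem_union, Finset.mem_insert,
        Finset.mem_singleton, Finset.notMem_empty, Finset.mem_erase] at hw h1 ⊢
      grind
  | untl φ ψ ih1 ih2 =>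
    intro w hw
    have h1 := @ih1 z x y w
    have h2 := @ih2 y x z w
    simp only [toFO, FOPlus.freeVars, Finset.mem_union, Finset.mem_insert,
      Finset.mem_singleton, Finset.mem_erase] at hw h1 h2 ⊢
    grind
  | release φ ψ ih1 ih2 =>
    intro w hw
    have h1 := @ih1 y x z w
    have h2 := @ih2 y x z w
    have h3 := @ih2 z x y w
    simp only [toFO, FOPlus.freeVars, Finset.mem_union, Finset.mem_insert,
      Finset.mem_singleton, Finset.mem_erase] at hw h1 h2 h3 ⊢
    grind

theorem sat_toFO (u : List (Set α)) (φ : LTLPlus α) (x y z : ℕ) (hxy : x ≠ y) (hxz : x ≠ z)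
    (hyz : y ≠ z) (ν : ℕ → ℕ) (hx : ν x < u.length) :
    (toFO hle hlt φ x y z).Sat u ν ↔ φ.Sat (u.drop (ν x)) := by
  have exists_drop : ∀ (k : ℕ) (p : ℕ → Prop), k < u.length →
      ((∃ i < (u.drop k).length, p i) ↔ ∃ j < u.length, k ≤ j ∧ p (j - k)) := by
    intro k p hk
    constructor
    · rintro ⟨i, hi, h⟩
      exact ⟨k + i, by simp at hi; omega, by omega, by simpa using h⟩
    · rintro ⟨j, hj, hkj, h⟩
      exact ⟨j - k, by simp; omega, h⟩
  have forall_drop : ∀ (k m : ℕ) (p : ℕ → Prop), m ≤ u.length →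
      ((∀ i < m - k, p i) ↔ ∀ j < u.length, (j < k ∨ m ≤ j) ∨ p (j - k)) := by
    intro k m p hm
    constructor
    · intro h j hj
      by_cases h' : j < k ∨ m ≤ j
      · exact Or.inl h'
      · exact Or.inr (h _ (by omega))
    · intro h i hi
      rcases h (k + i) (by omega) with h' | h'
      · omega
      · simpa using h'
  have drop_sub : ∀ (θ : LTLPlus α) {k j : ℕ}, k ≤ j →
      (θ.Sat ((u.drop k).drop (j - k)) ↔ θ.Sat (u.drop j)) := by
    intro θ k j h
    rw [List.drop_drop, Nat.add_sub_cancel' h]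
  -- The meaning of the part of the translation of `untl` that quantifies over `y`.
  have until_iff : ∀ (θ χ : LTLPlus α) (k : ℕ), k < u.length →
      ((∃ i < (u.drop k).length, χ.Sat ((u.drop k).drop i) ∧ ∀ j < i, θ.Sat ((u.drop k).drop j)) ↔
        ∃ j < u.length, (k ≤ j ∧ χ.Sat (u.drop j)) ∧
          ∀ l < u.length, (l < k ∨ j ≤ l) ∨ θ.Sat (u.drop l)) := by
    intro θ χ k hk
    rw [exists_drop k _ hk]
    refine exists_congr fun j => and_congr_right fun hj => ?_
    rw [and_assoc]
    refine and_congr_right fun hkj => and_congr (drop_sub χ hkj) ?_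
    rw [forall_drop k j _ hj.le]
    refine forall_congr' fun l => forall_congr' fun hl => ?_
    by_cases hkl : k ≤ l
    · rw [drop_sub θ hkl]
    · simp [not_le.1 hkl]
  -- Induction hypotheses are used at a position that has just been quantified.
  have sat_update : ∀ {θ : LTLPlus α} {χ : FOPlus B α} {w j : ℕ} (μ : ℕ → ℕ), j < u.length →
      (∀ μ, μ w < u.length → (χ.Sat u μ ↔ θ.Sat (u.drop (μ w)))) →
      (χ.Sat u (Function.update μ w j) ↔ θ.Sat (u.drop j)) := by
    intro θ χ w j μ hj h
    simpa using h (Function.update μ w j) (by simpa using hj)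
  have hyx := hxy.symm
  have hzx := hxz.symm
  have hzy := hyz.symm
  induction φ generalizing x y z ν with
  | bot => exact Iff.rfl
  | top => exact Iff.rfl
  | letter a =>
    simp only [toFO, FOPlus.Sat, Sat]
    simp
  | and φ ψ ih1 ih2 =>
    exact and_congr (ih1 x y z hxy hxz hyz ν hx hyx hzx hzy)
      (ih2 x y z hxy hxz hyz ν hx hyx hzx hzy)
  | or φ ψ ih1 ih2 =>
    exact or_congr (ih1 x y z hxy hxz hyz ν hx hyx hzx hzy)
      (ih2 x y z hxy hxz hyz ν hx hyx hzx hzy)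
  | next φ ih =>
    have e : ((open Classical in if φ.Sat [] then .top else .bot : FOPlus B α).Sat u ν) ↔
        φ.Sat [] := by
      by_cases h : φ.Sat [] <;> simp [h, FOPlus.Sat]
    have ih' : ∀ j < u.length, ((toFO hle hlt φ y x z).Sat u (Function.update ν y j) ↔
        φ.Sat (u.drop j)) := fun j hj => by
      exact sat_update ν hj fun μ hμ => ih y x z hyx hyz hxz μ hμ hxy hzy hzx
    simp only [toFO, FOPlus.Sat, Sat, BinPred.Holds, e, Function.update_self, ne_eq, hxy, hxz,
      hyz, not_false_eq_true, Function.update_of_ne, List.tail_drop]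
    constructor
    · rintro (⟨j, hj, ⟨hlt', hall⟩, h⟩ | ⟨hall, h⟩)
      · obtain rfl : j = ν x + 1 := by
          have := hall (ν x + 1) (by omega)
          omega
        exact (ih' _ hj).1 h
      · have : u.length ≤ ν x + 1 := by
          by_contra hcon
          have := hall (ν x + 1) (by omega)
          omega
        rwa [List.drop_eq_nil_of_le this]
    · intro h
      by_cases hlast : ν x + 1 < u.length
      · exact Or.inl ⟨_, hlast, ⟨by omega, fun l _ => by omega⟩, (ih' _ hlast).2 h⟩
      · rw [List.drop_eq_nil_of_le (not_lt.1 hlast)] at h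
        exact Or.inr ⟨fun l _ => by omega, h⟩
  | untl φ ψ ih1 ih2 =>
    refine Iff.trans ?_ (until_iff φ ψ (ν x) hx).symm
    refine exists_congr fun j => and_congr_right fun hj => and_congr (and_congr ?_ ?_) ?_
    · simp [FOPlus.Sat, BinPred.Holds, hxy]
    · exact sat_update _ hj fun μ hμ => ih2 y x z hyx hyz hxz μ hμ hxy hzy hzx
    · refine forall_congr' fun l => forall_congr' fun hl => or_congr ?_ ?_
      · simp [FOPlus.Sat, BinPred.Holds, hxy, hxz, hyz]
      · exact sat_update _ hl fun μ hμ => ih1 z x y hzx hzy hxy μ hμ hxz hyz hyx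
  | release φ ψ ih1 ih2 =>
    refine or_congr ?_ ?_
    · refine Iff.trans ?_ (until_iff ψ (and ψ φ) (ν x) hx).symm
      refine exists_congr fun j => and_congr_right fun hj =>
        and_congr (and_congr ?_ (and_congr ?_ ?_)) ?_
      · simp [FOPlus.Sat, BinPred.Holds, hxy]
      · exact sat_update _ hj fun μ hμ => ih2 y x z hyx hyz hxz μ hμ hxy hzy hzx
      · exact sat_update _ hj fun μ hμ => ih1 y x z hyx hyz hxz μ hμ hxy hzy hzx
      · refine forall_congr' fun l => forall_congr' fun hl => or_congr ?_ ?_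
        · simp [FOPlus.Sat, BinPred.Holds, hxy, hxz, hyz]
        · exact sat_update _ hl fun μ hμ => ih2 z x y hzx hzy hxy μ hμ hxz hyz hyx
    · rw [List.length_drop, forall_drop (ν x) u.length _ le_rfl]
      refine forall_congr' fun j => forall_congr' fun hj => ?_
      have e : (toFO hle hlt ψ y x z).Sat u (Function.update ν y j) ↔ ψ.Sat (u.drop j) := by
        exact sat_update _ hj fun μ hμ => ih2 y x z hyx hyz hxz μ hμ hxy hzy hzx
      simp only [FOPlus.Sat, BinPred.Holds, e, Function.update_self, ne_eq, hxy,
        not_false_eq_true, Function.update_of_ne, not_le.2 hj, or_false]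
      by_cases hkj : ν x ≤ j
      · rw [drop_sub ψ hkj]
      · simp [not_le.1 hkj]

end LTLPlus

theorem ltlPlusLanguages_subset {α : Type*} {B : Set BinPred} (hle : BinPred.le ∈ B)
    (hlt : BinPred.lt ∈ B) : ltlPlusLanguages α ⊆ fo3PlusLanguages B α := by
  rintro _ ⟨φ, rfl⟩
  -- On nonempty words, `φ` is expressed at the least position.
  let θ : FOPlus B α := φ.toFO hle hlt 0 1 2
  let χ : FOPlus B α := .ex 0 (.and (.all 1 (.rel .le hle 0 1)) θ)
  let ε : FOPlus B α := open Classical in if φ.Sat [] then .all 0 .bot else .bot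
  have hθ : θ.vars ⊆ {0, 1, 2} := LTLPlus.vars_toFO hle hlt φ 0 1 2
  have hθ' : θ.freeVars ⊆ {0} := LTLPlus.freeVars_toFO hle hlt φ 0 1 2
  refine ⟨.or χ ε, ?_, ?_, Set.ext fun u => ?_⟩
  · have : (FOPlus.or χ ε).vars ⊆ {0, 1, 2} := by
      intro w hw
      have := @hθ w
      by_cases he : φ.Sat [] <;>
      · simp only [χ, ε, FOPlus.vars, he, if_true, if_false, Finset.mem_union, Finset.mem_insert,
          Finset.mem_singleton, Finset.notMem_empty] at hw this ⊢
        tauto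
    exact (Finset.card_le_card this).trans (by decide)
  · refine Finset.eq_empty_of_forall_notMem fun w hw => ?_
    have := @hθ' w
    by_cases he : φ.Sat [] <;>
    · simp only [χ, ε, FOPlus.freeVars, he, if_true, if_false, Finset.mem_union, Finset.mem_insert,
        Finset.mem_singleton, Finset.notMem_empty, Finset.mem_erase] at hw this
      tauto
  · change (χ.Sat u _ ∨ ε.Sat u _) ↔ φ.Sat u
    have hε : ε.Sat u (fun _ => 0) ↔ u = [] ∧ φ.Sat [] := by
      by_cases he : φ.Sat []
      · simp only [ε, he, if_true, FOPlus.Sat, and_true]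
        cases u with
        | nil => simp
        | cons a u => simpa using ⟨0, by simp⟩
      · simp [ε, he, FOPlus.Sat]
    rw [hε]
    constructor
    · rintro (⟨i, hi, hmin, h⟩ | ⟨rfl, h⟩)
      · obtain rfl : i = 0 := by
          simpa [BinPred.Holds, FOPlus.Sat] using hmin 0 (by omega)
        simpa using (LTLPlus.sat_toFO hle hlt u φ 0 1 2 (by decide) (by decide) (by decide) _
          (by simpa using hi)).1 h
      · exact h
    · intro h
      cases u with
      | nil => exact Or.inr ⟨rfl, h⟩
      | cons a u =>
        refine Or.inl ⟨0, by simp, fun j _ => by simp [BinPred.Holds, FOPlus.Sat], ?_⟩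
        exact (LTLPlus.sat_toFO hle hlt _ φ 0 1 2 (by decide) (by decide) (by decide) _
          (by simp)).2 (by simpa using h)

theorem fo3PlusLanguages_subset (B : Set BinPred) (α : Type*) :
    fo3PlusLanguages B α ⊆ foPlusLanguages B α := by
  rintro _ ⟨φ, -, hφ, rfl⟩
  exact ⟨φ, hφ, rfl⟩

theorem theorem3p2 {α : Type*} [Finite α] (B : Set BinPred)
    (hB : B = BinPred.all ∨ B = BinPred.order) :
    foPlusLanguages B α = ltlPlusLanguages α ∧
      ltlPlusLanguages α = fo3PlusLanguages B α := by
  have hle : BinPred.le ∈ B := by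
    rcases hB with rfl | rfl <;> simp [BinPred.all, BinPred.order]
  have hlt : BinPred.lt ∈ B := by
    rcases hB with rfl | rfl <;> simp [BinPred.all, BinPred.order]
  have h1 := foPlusLanguages_subset (α := α) B
  have h2 := ltlPlusLanguages_subset (α := α) hle hlt
  have h3 := fo3PlusLanguages_subset B α
  exact ⟨h1.antisymm (h2.trans h3), h2.antisymm (h3.trans h1)⟩
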